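/- **Definitions.** Let $k\in\mathbb N=\{0,1,2,\dots\}$. A *topological $k$-graph* $(\Lambda,d)$ is a small category $\Lambda$ with range (codomain) and source (domain) maps $r,s:\operatorname{Mor}(\Lambda)\to\operatorname{Obj}(\Lambda)$ and a functor $d:\Lambda\to\mathbb N^k$ such that: $\operatorname{Obj}(\Lambda)$ and $\operatorname{Mor}(\Lambda)$ are second-countable locally compact Hausdorff spaces; $r,s$ are continuous and $s$ is a local homeomorphism; composition is a continuous open map from the space of composable pairs (with the subspace topology of the product) to $\operatorname{Mor}(\Lambda)$; $d$ is continuous for the discrete topology on $\mathbb N^k$; and whenever $d(\lambda)=m+n$ there is a unique composable pair $(\xi,\eta)$ with $\lambda=\xi\eta$, $d(\xi)=m$, $d(\eta)=n$. Write $\lambda\in\Lambda$ for $\lambda\in\operatorname{Mor}(\Lambda)$ and $\Lambda^m=d^{-1}(m)$. The graph is *compactly aligned* if for all $p,q\in\mathbb N^k$ and all compact $U\subset\Lambda^p$, $V\subset\Lambda^q$, the set $U\Lambda^{(p\vee q)-p}\cap V\Lambda^{(p\vee q)-q}$ is compact, where $p\vee q$ is the coordinatewise maximum. For $m\in(\mathbb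 N\cup\{\infty\})^k$ let $\Omega_{k,m}$ be the discrete topological $k$-graph with objects $\{p\in\mathbb N^k: p\le m\}$, morphisms $\{(p,q)\in\mathbb N^k\times\mathbb N^k:p\le q\le m\}$, $r(p,q)=p$, $s(p,q)=q$, $(n,p)(p,q)=(n,q)$, $d(p,q)=q-p$. The *path space* $X_\Lambda$ is the set of all continuous degree-preserving functors $x:\Omega_{k,m}\to\Lambda$, over all $m$; put $d(x)=m$ and $r(x)=x(0)$. For $n\in\mathbb N^k$ with $n\le d(x)$, $\sigma^n x$ is the path of degree $d(x)-n$ with $(\sigma^nx)(p,q)=x(n+p,n+q)$; for $\lambda\in\Lambda$ with $s(\lambda)=r(x)$, $\lambda x$ is the concatenated path, i.e. the unique path of degree $d(\lambda)+d(x)$ with $(\lambda x)(0,d(\lambda))=\lambda$ and $\sigma^{d(\lambda)}(\lambda x)=x$. The *path groupoid* $G_\Lambda$ has object set $X_\Lambda$ and morphisms the triples $(x,m,y)\in X_\Lambda\times\mathbb Z^k\times X_\Lambda$ for which there are $p,q\in\mathbb N^k$ with $p\le d(x)$, $q\le d(y)$, $p-q=m$ and $\sigma^px=\sigma^qy$ (equivalently,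 the triples $(\lambda z,d(\lambda)-d(\mu),\mu z)$ with $\lambda,\mu\in\Lambda$ and $z\in X_\Lambda$ such that $s(\lambda)=s(\mu)=r(z)$), with $r(x,m,y)=x$, $s(x,m,y)=y$, $(x,m,y)(y,n,z)=(x,m+n,z)$, $(x,m,y)^{-1}=(y,-m,x)$, and units $(x,0,x)$. Let $\Lambda*_s\Lambda=\{(\lambda,\mu):s(\lambda)=s(\mu)\}$ and $U*_sV=(U\times V)\cap(\Lambda*_s\Lambda)$. For $F\subset\Lambda*_s\Lambda$ and $m\in\mathbb Z^k$ put $$Z(F,m)=\{(\lambda z,d(\lambda)-d(\mu),\mu z):(\lambda,\mu)\in F,\ d(\lambda)-d(\mu)=m,\ z\in X_\Lambda,\ r(z)=s(\lambda)\}.$$ Give $G_\Lambda$ the topology generated by the sets $Z(U*_sV,m)\cap Z(F,m)^c$ with $m\in\mathbb Z^k$, $U,V\subset\Lambda$ open and $F\subset\Lambda*_s\Lambda$ compact. Give $X_\Lambda$ the topology of the unit space $G_\Lambda^{(0)}=\{(x,0,x):x\in X_\Lambda\}\subset G_\Lambda$ via $x\mapsto(x,0,x)$. **Theorem.** Let $(\Lambda,d)$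 be a compactly aligned topological $k$-graph. Then the sets $Z(U*_sV,m)\cap Z(F,m)^c$ form a basis of the topology of $G_\Lambda$, this topology is second-countable and Hausdorff, and $G_\Lambda$ is a locally compact $r$-discrete topological groupoid admitting a Haar system consisting of counting measures. That is: 1. $G_\Lambda$ is locally compact, and its range, source, inversion and composition maps are continuous; 2. the unit space $G_\Lambda^{(0)}$ is open in $G_\Lambda$; 3. the counting measures $\nu^x$ on the fibres $G_\Lambda^x=r^{-1}(x)$, regarded as Borel measures on $G_\Lambda$, form a Haar system: each $\nu^x$ is a Radon measure with support $G_\Lambda^x$; for every $f\in C_c(G_\Lambda)$ the function $x\mapsto\int f\,d\nu^x$ is continuous on $X_\Lambda$; and $\int f(gh)\,d\nu^{s(g)}(h)=\int f(h)\,d\nu^{r(g)}(h)$ for all $f\in C_c(G_\Lambda)$ and $g\in G_\Lambda$. -/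

import Mathlib

open MeasureTheory Topology

universe u v u' v'

namespace KGraph

/-- A small category, given by its set of objects, its set of morphisms, the range (codomain) and
source (domain) maps, identities, and composition of composable pairs.  The composite `f g` is
defined when `s f = r g`. -/
structure SmallCat where
  Obj : Type u
  Mor : Type v
  r : Mor → Obj
  s : Mor → Obj
  one : Obj → Mor
  comp : (f g : Mor) → s f = r g → Mor
  r_one : ∀ a, r (one a) = a
  s_one : ∀ a, s (one a) = a
  r_comp : ∀ f g h, r (comp f g h) = r f
  s_comp : ∀ f g h, s (comp f g h) = s g
  one_comp : ∀ f, comp (one (r f)) f (s_one (r f)) = f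
  comp_one : ∀ f, comp f (one (s f)) (r_one (s f)).symm = f
  assoc : ∀ f g h (hfg : s f = r g) (hgh : s g = r h),
    comp (comp f g hfg) h ((s_comp f g hfg).trans hgh) =
      comp f (comp g h hgh) (hfg.trans (r_comp g h hgh).symm)

/-- The set `C ×_c C` of composable pairs of morphisms. -/
def SmallCat.Composable (C : SmallCat.{u, v}) : Type v :=
  {p : C.Mor × C.Mor // C.s p.1 = C.r p.2}

instance (C : SmallCat.{u, v}) [TopologicalSpace C.Mor] : TopologicalSpace C.Composable :=
  inferInstanceAs (TopologicalSpace {p : C.Mor × C.Mor // C.s p.1 = C.r p.2})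

/-- Composition as a map on composable pairs. -/
def SmallCat.compMap (C : SmallCat.{u, v}) (p : C.Composable) : C.Mor :=
  C.comp p.1.1 p.1.2 p.2

/-- A topological `k`-graph: a small category `Λ` with topologies on objects and morphisms and a
degree functor `d` to the monoid `ℕ^k` with the unique factorization property. -/
structure TopKGraph (k : ℕ) extends SmallCat.{u, v} where
  [topObj : TopologicalSpace Obj]
  [topMor : TopologicalSpace Mor]
  [secondCountableObj : SecondCountableTopology Obj]
  [secondCountableMor : SecondCountableTopology Mor]
  [locallyCompactObj : LocallyCompactSpace Obj]
  [locallyCompactMor : LocallyCompactSpace Mor]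
  [t2Obj : T2Space Obj]
  [t2Mor : T2Space Mor]
  continuous_r : Continuous r
  continuous_s : Continuous s
  isLocalHomeomorph_s : IsLocalHomeomorph s
  continuous_comp : Continuous toSmallCat.compMap
  isOpenMap_comp : IsOpenMap toSmallCat.compMap
  d : Mor → Fin k → ℕ
  d_one : ∀ a, d (one a) = 0
  d_comp : ∀ f g h, d (comp f g h) = d f + d g
  continuous_d : Continuous d
  factorization : ∀ (f : Mor) (m n : Fin k → ℕ), d f = m + n →
    ∃! p : Mor × Mor, (∃ h : s p.1 = r p.2, comp p.1 p.2 h = f) ∧ d p.1 = m ∧ d p.2 = n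

attribute [instance] TopKGraph.topObj TopKGraph.topMor TopKGraph.secondCountableObj
  TopKGraph.secondCountableMor TopKGraph.locallyCompactObj TopKGraph.locallyCompactMor
  TopKGraph.t2Obj TopKGraph.t2Mor

variable {k : ℕ}

/-! ### Compact alignment -/

/-- The set `U W` of composites of a path in `U` and a path in `W`. -/
def TopKGraph.setComp (Λ : TopKGraph.{u, v} k) (U W : Set Λ.Mor) : Set Λ.Mor :=
  {f | ∃ ξ ∈ U, ∃ η ∈ W, ∃ h : Λ.s ξ = Λ.r η, Λ.comp ξ η h = f}

/-- The set `Λ^m` of paths of degree `m`. -/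
def TopKGraph.ofDegree (Λ : TopKGraph.{u, v} k) (m : Fin k → ℕ) : Set Λ.Mor := {f | Λ.d f = m}

/-- The set `U ∨ V = U Λ^{(p ∨ q) - p} ∩ V Λ^{(p ∨ q) - q}` of minimal common extensions, for
`U ⊆ Λ^p` and `V ⊆ Λ^q`. -/
def TopKGraph.minExt (Λ : TopKGraph.{u, v} k) (p q : Fin k → ℕ) (U V : Set Λ.Mor) : Set Λ.Mor :=
  Λ.setComp U (Λ.ofDegree (p ⊔ q - p)) ∩ Λ.setComp V (Λ.ofDegree (p ⊔ q - q))

/-- `Λ` is compactly aligned if `U ∨ V` is compact for all compact `U ⊆ Λ^p`, `V ⊆ Λ^q`. -/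
def TopKGraph.CompactlyAligned (Λ : TopKGraph.{u, v} k) : Prop :=
  ∀ (p q : Fin k → ℕ) (U V : Set Λ.Mor), U ⊆ Λ.ofDegree p → V ⊆ Λ.ofDegree q →
    IsCompact U → IsCompact V → IsCompact (Λ.minExt p q U V)

/-! ### Graph morphisms and the path prototypes -/

/-- A graph morphism: a continuous degree-preserving functor. -/
@[ext]
structure GraphMorphism (Λ₁ : TopKGraph.{u, v} k) (Λ₂ : TopKGraph.{u', v'} k) where
  obj : Λ₁.Obj → Λ₂.Obj
  mor : Λ₁.Mor → Λ₂.Mor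
  map_r : ∀ f, Λ₂.r (mor f) = obj (Λ₁.r f)
  map_s : ∀ f, Λ₂.s (mor f) = obj (Λ₁.s f)
  map_one : ∀ a, mor (Λ₁.one a) = Λ₂.one (obj a)
  map_comp : ∀ f g (h : Λ₁.s f = Λ₁.r g), mor (Λ₁.comp f g h) =
    Λ₂.comp (mor f) (mor g) ((map_s f).trans ((congrArg obj h).trans (map_r g).symm))
  map_d : ∀ f, Λ₂.d (mor f) = Λ₁.d f
  continuous_obj : Continuous obj
  continuous_mor : Continuous mor

/-- `p ≤ m` for `p ∈ ℕ^k` and `m ∈ (ℕ ∪ {∞})^k`. -/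
def Below (p : Fin k → ℕ) (m : Fin k → ℕ∞) : Prop := ∀ i, (p i : ℕ∞) ≤ m i

theorem Below.mono {p q : Fin k → ℕ} {m : Fin k → ℕ∞} (h : p ≤ q) (hq : Below q m) : Below p m :=
  fun i => le_trans (by exact_mod_cast h i) (hq i)

/-- The objects of `Ω_{k,m}`. -/
def OmegaObj (m : Fin k → ℕ∞) : Type := {p : Fin k → ℕ // Below p m}

/-- The morphisms `(p, q)`, `p ≤ q ≤ m`, of `Ω_{k,m}`. -/
def OmegaMor (m : Fin k → ℕ∞) : Type :=
  {p : (Fin k → ℕ) × (Fin k → ℕ) // p.1 ≤ p.2 ∧ Below p.2 m}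

/-- The small category underlying `Ω_{k,m}`; `(p, q)` has range `p` and source `q`. -/
def omegaCat (m : Fin k → ℕ∞) : SmallCat.{0, 0} where
  Obj := OmegaObj m
  Mor := OmegaMor m
  r f := ⟨f.1.1, f.2.2.mono f.2.1⟩
  s f := ⟨f.1.2, f.2.2⟩
  one a := ⟨(a.1, a.1), le_rfl, a.2⟩
  comp f g h := ⟨(f.1.1, g.1.2), f.2.1.trans ((congrArg Subtype.val h).le.trans g.2.1), g.2.2⟩
  r_one _ := rfl
  s_one _ := rfl
  r_comp _ _ _ := rfl
  s_comp _ _ _ := rfl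
  one_comp _ := rfl
  comp_one _ := rfl
  assoc _ _ _ _ _ := rfl

instance (m : Fin k → ℕ∞) : TopologicalSpace (omegaCat m).Obj := ⊥
instance (m : Fin k → ℕ∞) : TopologicalSpace (omegaCat m).Mor := ⊥
instance (m : Fin k → ℕ∞) : DiscreteTopology (omegaCat m).Obj := ⟨rfl⟩
instance (m : Fin k → ℕ∞) : DiscreteTopology (omegaCat m).Mor := ⟨rfl⟩
instance (m : Fin k → ℕ∞) : Countable (omegaCat m).Obj :=
  inferInstanceAs (Countable {p : Fin k → ℕ // Below p m})
instance (m : Fin k → ℕ∞) : Countable (omegaCat m).Mor :=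
  inferInstanceAs (Countable {p : (Fin k → ℕ) × (Fin k → ℕ) // p.1 ≤ p.2 ∧ Below p.2 m})

theorem isLocalHomeomorph_of_discrete {X Y : Type*} [TopologicalSpace X] [TopologicalSpace Y]
    [DiscreteTopology X] [DiscreteTopology Y] (f : X → Y) : IsLocalHomeomorph f := by
  rw [isLocalHomeomorph_iff_isOpenEmbedding_restrict]
  intro x
  refine ⟨{x}, by simp, ?_⟩
  refine .of_continuous_injective_isOpenMap continuous_of_discreteTopology ?_ ?_
  · intro a b _
    exact Subtype.ext (a.2.trans b.2.symm)
  · intro U _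
    exact isOpen_discrete _

instance (m : Fin k → ℕ∞) : DiscreteTopology (omegaCat m).Composable :=
  inferInstanceAs (DiscreteTopology
    {p : (omegaCat m).Mor × (omegaCat m).Mor // (omegaCat m).s p.1 = (omegaCat m).r p.2})

theorem omega_d_comp {m : Fin k → ℕ∞} (f g : OmegaMor m) (h : f.1.2 = g.1.1) :
    g.1.2 - f.1.1 = (f.1.2 - f.1.1) + (g.1.2 - g.1.1) := by
  funext i
  have h1 : f.1.1 i ≤ f.1.2 i := f.2.1 i
  have h2 : g.1.1 i ≤ g.1.2 i := g.2.1 i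
  have h3 := congrFun h i
  simp only [Pi.add_apply, Pi.sub_apply]
  omega

theorem omega_factorization {m : Fin k → ℕ∞} (f : (omegaCat m).Mor) (a b : Fin k → ℕ)
    (hab : f.1.2 - f.1.1 = a + b) :
    ∃! p : (omegaCat m).Mor × (omegaCat m).Mor,
      (∃ h : (omegaCat m).s p.1 = (omegaCat m).r p.2, (omegaCat m).comp p.1 p.2 h = f) ∧
        p.1.1.2 - p.1.1.1 = a ∧ p.2.1.2 - p.2.1.1 = b := by
  have hf : ∀ i, f.1.1 i ≤ f.1.2 i := f.2.1
  have hab' : ∀ i, f.1.2 i - f.1.1 i = a i + b i := fun i => congrFun hab i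
  have hle : f.1.1 + a ≤ f.1.2 := fun i => by
    have := hf i; have := hab' i; simp only [Pi.add_apply]; omega
  refine ⟨(⟨(f.1.1, f.1.1 + a), fun i => by simp, f.2.2.mono hle⟩,
    ⟨(f.1.1 + a, f.1.2), hle, f.2.2⟩), ⟨⟨rfl, rfl⟩, ?_, ?_⟩, ?_⟩
  · funext i; simp
  · funext i; have := hf i; have := hab' i; simp only [Pi.add_apply, Pi.sub_apply]; omega
  · rintro ⟨x, y⟩ ⟨⟨h, rfl⟩, hx, hy⟩
    have h' : x.1.2 = y.1.1 := congrArg Subtype.val h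
    have e3 : x.1.2 = x.1.1 + a := by
      funext i
      have hx' : x.1.2 i - x.1.1 i = a i := congrFun hx i
      have : x.1.1 i ≤ x.1.2 i := x.2.1 i
      simp only [Pi.add_apply]; omega
    exact Prod.ext (Subtype.ext (Prod.ext rfl e3)) (Subtype.ext (Prod.ext (h'.symm.trans e3) rfl))

/-- The discrete topological `k`-graph `Ω_{k,m}`, with degree map `d(p, q) = q - p`. -/
def Omega (m : Fin k → ℕ∞) : TopKGraph.{0, 0} k where
  __ := omegaCat m
  topObj := instTopologicalSpaceObjOmegaCat m
  topMor := instTopologicalSpaceMorOmegaCat m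
  secondCountableObj := inferInstanceAs (SecondCountableTopology (omegaCat m).Obj)
  secondCountableMor := inferInstanceAs (SecondCountableTopology (omegaCat m).Mor)
  locallyCompactObj := inferInstanceAs (LocallyCompactSpace (omegaCat m).Obj)
  locallyCompactMor := inferInstanceAs (LocallyCompactSpace (omegaCat m).Mor)
  t2Obj := inferInstanceAs (T2Space (omegaCat m).Obj)
  t2Mor := inferInstanceAs (T2Space (omegaCat m).Mor)
  continuous_r := continuous_of_discreteTopology (α := (omegaCat m).Mor)
  continuous_s := continuous_of_discreteTopology (α := (omegaCat m).Mor)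
  isLocalHomeomorph_s :=
    isLocalHomeomorph_of_discrete (X := (omegaCat m).Mor) (Y := (omegaCat m).Obj) _
  continuous_comp := continuous_of_discreteTopology (α := (omegaCat m).Composable)
  isOpenMap_comp := fun _ _ => isOpen_discrete (α := (omegaCat m).Mor) _
  d f := f.1.2 - f.1.1
  d_one a := tsub_self a.1
  d_comp f g h := omega_d_comp f g (congrArg Subtype.val h)
  continuous_d := continuous_of_discreteTopology (α := (omegaCat m).Mor)
  factorization := omega_factorization

/-! ### The path space -/

/-- The path space `X_Λ`: graph morphisms `Ω_{k,m} → Λ` for all `m ∈ (ℕ ∪ {∞})^k`. -/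
def PathSpace (Λ : TopKGraph.{u, v} k) : Type (max u v) :=
  Σ m : Fin k → ℕ∞, GraphMorphism (Omega m) Λ

namespace PathSpace

variable {Λ : TopKGraph.{u, v} k}

/-- The degree of a path. -/
def deg (x : PathSpace Λ) : Fin k → ℕ∞ := x.1

/-- The vertex `x(p)`. -/
def vertex (x : PathSpace Λ) (p : Fin k → ℕ) (hp : Below p x.deg) : Λ.Obj := x.2.obj ⟨p, hp⟩

/-- The segment `x(p, q)`. -/
def seg (x : PathSpace Λ) (p q : Fin k → ℕ) (hpq : p ≤ q) (hq : Below q x.deg) : Λ.Mor :=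
  x.2.mor ⟨(p, q), hpq, hq⟩

theorem below_zero (m : Fin k → ℕ∞) : Below 0 m := fun i => by simp

/-- The range `r(x) = x(0)`. -/
def r (x : PathSpace Λ) : Λ.Obj := x.vertex 0 (below_zero _)

theorem ext_seg {x y : PathSpace Λ} (hd : x.deg = y.deg)
    (h : ∀ p q hpq hq hq', x.seg p q hpq hq = y.seg p q hpq hq') : x = y := by
  obtain ⟨m, f⟩ := x
  obtain ⟨m', g⟩ := y
  obtain rfl : m = m' := hd
  have hmor : f.mor = g.mor := funext fun a => h a.1.1 a.1.2 a.2.1 a.2.2 a.2.2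
  have hobj : f.obj = g.obj := by
    funext a
    have h1 := f.map_r ((Omega m).one a)
    have h2 := g.map_r ((Omega m).one a)
    rw [(Omega m).r_one] at h1 h2
    rw [← h1, ← h2, hmor]
  exact congrArg (Sigma.mk m) (GraphMorphism.ext hobj hmor)

theorem below_shift {m : Fin k → ℕ∞} {n a : Fin k → ℕ} (hn : Below n m)
    (ha : Below a (fun i => m i - (n i : ℕ∞))) : Below (n + a) m := fun i => by
  have h1 := hn i
  have h2 := ha i
  simp only [Pi.add_apply, Nat.cast_add]
  calc (n i : ℕ∞) + a i ≤ n i + (m i - n i) := by gcongr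
    _ = m i := add_tsub_cancel_of_le h1

/-- The shifted path `σ^n x` for `n ≤ d(x)`: it has degree `d(x) - n` and
`(σ^n x)(p, q) = x(n + p, n + q)`. -/
def shift (n : Fin k → ℕ) (x : PathSpace Λ) (hn : Below n x.deg) : PathSpace Λ :=
  ⟨fun i => x.deg i - (n i : ℕ∞),
    { obj := fun a => x.vertex (n + a.1) (below_shift hn a.2)
      mor := fun f => x.seg (n + f.1.1) (n + f.1.2) (add_le_add le_rfl f.2.1)
        (below_shift hn f.2.2)
      map_r := fun f => x.2.map_r _
      map_s := fun f => x.2.map_s _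
      map_one := fun a => x.2.map_one ⟨n + a.1, below_shift hn a.2⟩
      map_comp := fun f g h => by
        have h' : f.1.2 = g.1.1 := congrArg Subtype.val h
        exact x.2.map_comp ⟨(n + f.1.1, n + f.1.2), add_le_add le_rfl f.2.1, below_shift hn f.2.2⟩
          ⟨(n + g.1.1, n + g.1.2), add_le_add le_rfl g.2.1, below_shift hn g.2.2⟩
          (Subtype.ext (by change n + f.1.2 = n + g.1.1; rw [h']))
      map_d := fun f => by
        refine (x.2.map_d _).trans ?_
        funext i
        change n i + f.1.2 i - (n i + f.1.1 i) = f.1.2 i - f.1.1 i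
        omega
      continuous_obj := continuous_of_discreteTopology (α := (omegaCat _).Obj)
      continuous_mor := continuous_of_discreteTopology (α := (omegaCat _).Mor) }⟩

theorem seg_congr (x : PathSpace Λ) {p q p' q' : Fin k → ℕ} (hp : p = p') (hq : q = q')
    (h1 : p ≤ q) (h2 : Below q x.deg) :
    x.seg p q h1 h2 = x.seg p' q' (hp ▸ hq ▸ h1) (hq ▸ h2) := by
  subst hp hq; rfl

theorem s_path_seg (x : PathSpace Λ) (p q : Fin k → ℕ) (hpq : p ≤ q) (hq : Below q x.deg) :
    Λ.s (x.seg p q hpq hq) = x.vertex q hq := x.2.map_s _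

theorem r_path_seg (x : PathSpace Λ) (p q : Fin k → ℕ) (hpq : p ≤ q) (hq : Below q x.deg) :
    Λ.r (x.seg p q hpq hq) = x.vertex p (hq.mono hpq) := x.2.map_r _

theorem path_seg_comp (x : PathSpace Λ) (p q t : Fin k → ℕ) (hpq : p ≤ q) (hqt : q ≤ t)
    (ht : Below t x.deg) : x.seg p t (hpq.trans hqt) ht =
      Λ.comp (x.seg p q hpq (ht.mono hqt)) (x.seg q t hqt ht)
        ((s_path_seg _ _ _ _ _).trans (r_path_seg _ _ _ _ _).symm) :=
  x.2.map_comp ⟨(p, q), hpq, ht.mono hqt⟩ ⟨(q, t), hqt, ht⟩ rfl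

theorem shift_shift (x : PathSpace Λ) (n a : Fin k → ℕ) (hn : Below n x.deg)
    (ha : Below a (shift n x hn).deg) (hna : Below (n + a) x.deg) :
    shift a (shift n x hn) ha = shift (n + a) x hna := by
  refine ext_seg ?_ ?_
  · funext i
    change x.deg i - (n i : ℕ∞) - (a i : ℕ∞) = x.deg i - ((n i + a i : ℕ) : ℕ∞)
    rw [Nat.cast_add, tsub_add_eq_tsub_tsub]
  · intro p q hpq hq hq'
    exact seg_congr x (add_assoc n a p).symm (add_assoc n a q).symm
      (add_le_add le_rfl (add_le_add le_rfl hpq)) (below_shift hn (below_shift ha hq))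

end PathSpace

/-! ### Segments of finite paths and concatenation -/

namespace TopKGraph

variable (Λ : TopKGraph.{u, v} k)

theorem exists_factor (f : Λ.Mor) (m : Fin k → ℕ) (hm : m ≤ Λ.d f) :
    ∃ p : Λ.Mor × Λ.Mor, (∃ h : Λ.s p.1 = Λ.r p.2, Λ.comp p.1 p.2 h = f) ∧
      Λ.d p.1 = m ∧ Λ.d p.2 = Λ.d f - m :=
  (Λ.factorization f m (Λ.d f - m) (add_tsub_cancel_of_le hm).symm).exists

/-- The initial segment `f(0, m)`. -/
noncomputable def head (f : Λ.Mor) (m : Fin k → ℕ) (hm : m ≤ Λ.d f) : Λ.Mor :=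
  (Λ.exists_factor f m hm).choose.1

/-- The final segment `f(m, d(f))`. -/
noncomputable def tail (f : Λ.Mor) (m : Fin k → ℕ) (hm : m ≤ Λ.d f) : Λ.Mor :=
  (Λ.exists_factor f m hm).choose.2

variable {Λ}

theorem s_head (f : Λ.Mor) (m : Fin k → ℕ) (hm : m ≤ Λ.d f) :
    Λ.s (Λ.head f m hm) = Λ.r (Λ.tail f m hm) := (Λ.exists_factor f m hm).choose_spec.1.choose

theorem head_comp_tail (f : Λ.Mor) (m : Fin k → ℕ) (hm : m ≤ Λ.d f) :
    Λ.comp (Λ.head f m hm) (Λ.tail f m hm) (s_head f m hm) = f :=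
  (Λ.exists_factor f m hm).choose_spec.1.choose_spec

theorem d_head (f : Λ.Mor) (m : Fin k → ℕ) (hm : m ≤ Λ.d f) : Λ.d (Λ.head f m hm) = m :=
  (Λ.exists_factor f m hm).choose_spec.2.1

theorem d_tail (f : Λ.Mor) (m : Fin k → ℕ) (hm : m ≤ Λ.d f) : Λ.d (Λ.tail f m hm) = Λ.d f - m :=
  (Λ.exists_factor f m hm).choose_spec.2.2

theorem factor_unique {a b a' b' : Λ.Mor} (h : Λ.s a = Λ.r b) (h' : Λ.s a' = Λ.r b')
    (hc : Λ.comp a b h = Λ.comp a' b' h') (hd : Λ.d a = Λ.d a') : a = a' ∧ b = b' := by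
  have hdd : Λ.d a + Λ.d b = Λ.d a' + Λ.d b' := by rw [← Λ.d_comp _ _ h, ← Λ.d_comp _ _ h', hc]
  have hb : Λ.d b = Λ.d b' := by rw [hd] at hdd; exact add_left_cancel hdd
  have := (Λ.factorization _ _ _ (Λ.d_comp a b h)).unique (y₁ := (a, b)) (y₂ := (a', b'))
    ⟨⟨h, rfl⟩, rfl, rfl⟩ ⟨⟨h', hc.symm⟩, hd.symm, hb.symm⟩
  exact ⟨congrArg Prod.fst this, congrArg Prod.snd this⟩

theorem eq_head_tail {a b f : Λ.Mor} (h : Λ.s a = Λ.r b) (hc : Λ.comp a b h = f)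
    (hm : Λ.d a ≤ Λ.d f) : Λ.head f (Λ.d a) hm = a ∧ Λ.tail f (Λ.d a) hm = b :=
  factor_unique (s_head _ _ _) h ((head_comp_tail _ _ _).trans hc.symm) (d_head _ _ _)

theorem eq_one_of_d_eq_zero {f : Λ.Mor} (h : Λ.d f = 0) : f = Λ.one (Λ.s f) := by
  have := factor_unique (Λ.s_one (Λ.r f)) (Λ.r_one (Λ.s f)).symm
    ((Λ.one_comp f).trans (Λ.comp_one f).symm) (by rw [h, Λ.d_one])
  exact this.2

theorem comp_congr {a b a' b' : Λ.Mor} (ha : a = a') (hb : b = b') (h : Λ.s a = Λ.r b)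
    (h' : Λ.s a' = Λ.r b') : Λ.comp a b h = Λ.comp a' b' h' := by
  subst ha hb; rfl

theorem head_comp (f g : Λ.Mor) (h : Λ.s f = Λ.r g) (m : Fin k → ℕ) (hm : m ≤ Λ.d f)
    (hm' : m ≤ Λ.d (Λ.comp f g h)) : Λ.head (Λ.comp f g h) m hm' = Λ.head f m hm := by
  have hs : Λ.s (Λ.tail f m hm) = Λ.r g := by
    rw [← h, ← Λ.s_comp _ _ (s_head f m hm), head_comp_tail]
  refine (factor_unique (s_head _ _ hm') ((s_head f m hm).trans (Λ.r_comp _ g hs).symm) ?_ ?_).1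
  · rw [head_comp_tail, ← Λ.assoc]
    exact comp_congr (head_comp_tail f m hm).symm rfl _ _
  · rw [d_head, d_head]

variable (Λ) in
/-- The segment `f(p, q)` of a path `f`, for `p ≤ q ≤ d(f)`. -/
noncomputable def seg (f : Λ.Mor) (p q : Fin k → ℕ) (hpq : p ≤ q) (hq : q ≤ Λ.d f) : Λ.Mor :=
  Λ.tail (Λ.head f q hq) p (hpq.trans (d_head f q hq).ge)

theorem seg_comp (f g : Λ.Mor) (h : Λ.s f = Λ.r g) (p q : Fin k → ℕ) (hpq : p ≤ q)
    (hq : q ≤ Λ.d f) (hq' : q ≤ Λ.d (Λ.comp f g h)) :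
    Λ.seg (Λ.comp f g h) p q hpq hq' = Λ.seg f p q hpq hq := by
  unfold seg
  congr 1
  exact head_comp f g h q hq hq'

theorem head_head (f : Λ.Mor) (p q : Fin k → ℕ) (hpq : p ≤ q) (hq : q ≤ Λ.d f)
    (hp : p ≤ Λ.d (Λ.head f q hq)) :
    Λ.head (Λ.head f q hq) p hp = Λ.head f p (hpq.trans hq) := by
  have key := head_comp (Λ.head f q hq) (Λ.tail f q hq) (s_head f q hq) p hp
    (by rw [head_comp_tail]; exact hpq.trans hq)
  rw [← key]
  congr 1
  exact head_comp_tail f q hq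

theorem d_seg (f : Λ.Mor) (p q : Fin k → ℕ) (hpq : p ≤ q) (hq : q ≤ Λ.d f) :
    Λ.d (Λ.seg f p q hpq hq) = q - p := by
  unfold seg; rw [d_tail, d_head]

theorem s_seg (f : Λ.Mor) (p q : Fin k → ℕ) (hpq : p ≤ q) (hq : q ≤ Λ.d f) :
    Λ.s (Λ.seg f p q hpq hq) = Λ.s (Λ.head f q hq) := by
  unfold seg
  rw [← Λ.s_comp _ _ (s_head (Λ.head f q hq) p (hpq.trans (d_head f q hq).ge)), head_comp_tail]

theorem r_seg (f : Λ.Mor) (p q : Fin k → ℕ) (hpq : p ≤ q) (hq : q ≤ Λ.d f) :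
    Λ.r (Λ.seg f p q hpq hq) = Λ.s (Λ.head f p (hpq.trans hq)) := by
  unfold seg
  rw [← s_head, head_head _ _ _ hpq]

theorem head_comp_seg (f : Λ.Mor) (p q : Fin k → ℕ) (hpq : p ≤ q) (hq : q ≤ Λ.d f) :
    Λ.comp (Λ.head f p (hpq.trans hq)) (Λ.seg f p q hpq hq) (r_seg f p q hpq hq).symm =
      Λ.head f q hq := by
  refine Eq.trans ?_ (head_comp_tail (Λ.head f q hq) p (hpq.trans (d_head f q hq).ge))
  exact comp_congr (head_head f p q hpq hq _).symm rfl _ _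

theorem seg_comp_seg (f : Λ.Mor) (p q t : Fin k → ℕ) (hpq : p ≤ q) (hqt : q ≤ t)
    (ht : t ≤ Λ.d f) (h : Λ.s (Λ.seg f p q hpq (hqt.trans ht)) = Λ.r (Λ.seg f q t hqt ht)) :
    Λ.comp (Λ.seg f p q hpq (hqt.trans ht)) (Λ.seg f q t hqt ht) h =
      Λ.seg f p t (hpq.trans hqt) ht := by
  refine (factor_unique (a := Λ.head f p (hpq.trans (hqt.trans ht)))
    (a' := Λ.head f p (hpq.trans (hqt.trans ht)))
    ((r_seg _ _ _ hpq (hqt.trans ht)).symm.trans (Λ.r_comp _ _ h).symm)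
    (r_seg _ _ _ (hpq.trans hqt) ht).symm ?_ rfl).2
  rw [head_comp_seg, ← Λ.assoc, ← head_comp_seg f q t hqt ht]
  exact comp_congr (head_comp_seg f p q hpq (hqt.trans ht)) rfl _ _

end TopKGraph

namespace PathSpace

open TopKGraph

variable {Λ : TopKGraph.{u, v} k}

theorem below_sub {a q : Fin k → ℕ} {m : Fin k → ℕ∞} (hq : Below q (fun i => (a i : ℕ∞) + m i)) :
    Below (q - a) m := fun i => by
  have h := hq i
  simp only [Pi.sub_apply, ENat.natCast_sub]
  exact tsub_le_iff_left.mpr h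

/-- The finite path `f x(0, (q - d(f)) ∨ 0)`, which has degree `q ∨ d(f)`. -/
def word (f : Λ.Mor) (x : PathSpace Λ) (h : Λ.s f = x.r) (q : Fin k → ℕ)
    (hq : Below q (fun i => (Λ.d f i : ℕ∞) + x.deg i)) : Λ.Mor :=
  Λ.comp f (x.seg 0 (q - Λ.d f) (fun _ => Nat.zero_le _) (below_sub hq))
    (h.trans (r_path_seg _ _ _ _ _).symm)

theorem d_path_seg (x : PathSpace Λ) (p q : Fin k → ℕ) (hpq : p ≤ q) (hq : Below q x.deg) :
    Λ.d (x.seg p q hpq hq) = q - p := x.2.map_d _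

theorem le_d_word (f : Λ.Mor) (x : PathSpace Λ) (h : Λ.s f = x.r) (q : Fin k → ℕ)
    (hq : Below q (fun i => (Λ.d f i : ℕ∞) + x.deg i)) : q ≤ Λ.d (word f x h q hq) := fun i => by
  unfold word
  rw [Λ.d_comp, d_path_seg]
  simp only [Pi.add_apply, Pi.sub_apply, Pi.zero_apply]
  omega

theorem word_comp (f : Λ.Mor) (x : PathSpace Λ) (h : Λ.s f = x.r) (q t : Fin k → ℕ) (hqt : q ≤ t)
    (ht : Below t (fun i => (Λ.d f i : ℕ∞) + x.deg i)) :
    ∃ (g : Λ.Mor) (hg : Λ.s (word f x h q (ht.mono hqt)) = Λ.r g),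
      word f x h t ht = Λ.comp (word f x h q (ht.mono hqt)) g hg := by
  have hle : q - Λ.d f ≤ t - Λ.d f := tsub_le_tsub_right hqt _
  have hs : Λ.s (word f x h q (ht.mono hqt)) =
      Λ.r (x.seg (q - Λ.d f) (t - Λ.d f) hle (below_sub ht)) := by
    unfold word
    rw [Λ.s_comp]
    exact (s_path_seg _ _ _ _ _).trans (r_path_seg _ _ _ _ _).symm
  refine ⟨_, hs, ?_⟩
  unfold word
  rw [Λ.assoc]
  exact comp_congr rfl (path_seg_comp x 0 (q - Λ.d f) (t - Λ.d f) (fun _ => Nat.zero_le _) hle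
    (below_sub ht)) _ _

theorem head_word (f : Λ.Mor) (x : PathSpace Λ) (h : Λ.s f = x.r) (p q t : Fin k → ℕ) (hpq : p ≤ q)
    (hqt : q ≤ t) (ht : Below t (fun i => (Λ.d f i : ℕ∞) + x.deg i)) :
    Λ.head (word f x h q (ht.mono hqt)) p (hpq.trans (le_d_word f x h q _)) =
      Λ.head (word f x h t ht) p (hpq.trans (hqt.trans (le_d_word f x h t ht))) := by
  obtain ⟨g, hg, e⟩ := word_comp f x h q t hqt ht
  rw [← head_comp _ g hg p _ (by rw [← e]; exact hpq.trans (hqt.trans (le_d_word f x h t ht)))]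
  congr 1
  exact e.symm

theorem seg_word (f : Λ.Mor) (x : PathSpace Λ) (h : Λ.s f = x.r) (p q t : Fin k → ℕ) (hpq : p ≤ q)
    (hqt : q ≤ t) (ht : Below t (fun i => (Λ.d f i : ℕ∞) + x.deg i)) :
    Λ.seg (word f x h q (ht.mono hqt)) p q hpq (le_d_word f x h q _) =
      Λ.seg (word f x h t ht) p q hpq (hqt.trans (le_d_word f x h t ht)) := by
  unfold TopKGraph.seg
  congr 1
  exact head_word f x h q q t le_rfl hqt ht

/-- The concatenation `f x`, for `s(f) = r(x)`: it has degree `d(f) + d(x)`, and `(f x)(p, q)` is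
the segment from `p` to `q` of the finite path `f x(0, (q - d(f)) ∨ 0)`. -/
noncomputable def concat (f : Λ.Mor) (x : PathSpace Λ) (h : Λ.s f = x.r) : PathSpace Λ :=
  ⟨fun i => (Λ.d f i : ℕ∞) + x.deg i,
    { obj := fun a => Λ.s (Λ.head (word f x h a.1 a.2) a.1 (le_d_word f x h a.1 a.2))
      mor := fun e => Λ.seg (word f x h e.1.2 e.2.2) e.1.1 e.1.2 e.2.1 (le_d_word f x h _ _)
      map_r := fun e => by
        rw [r_seg]
        exact congrArg Λ.s (head_word f x h e.1.1 e.1.1 e.1.2 le_rfl e.2.1 e.2.2).symm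
      map_s := fun e => s_seg _ _ _ _ _
      map_one := fun a => by
        have h0 := eq_one_of_d_eq_zero (f := Λ.seg (word f x h a.1 a.2) a.1 a.1 le_rfl
          (le_d_word f x h _ _)) (by rw [d_seg, tsub_self])
        rw [s_seg] at h0
        exact h0
      map_comp := fun e g hh => by
        obtain ⟨⟨p, q⟩, hpq, hq⟩ := e
        obtain ⟨⟨q', t⟩, hqt, ht⟩ := g
        obtain rfl : q = q' := congrArg Subtype.val hh
        refine Eq.trans (seg_comp_seg (word f x h t ht) p q t hpq hqt (le_d_word f x h t ht)
          ((s_seg _ _ _ _ _).trans (r_seg _ _ _ _ _).symm)).symm ?_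
        exact comp_congr (seg_word f x h p q t hpq hqt ht).symm rfl _ _
      map_d := fun e => d_seg _ _ _ _ _
      continuous_obj := continuous_of_discreteTopology (α := (omegaCat _).Obj)
      continuous_mor := continuous_of_discreteTopology (α := (omegaCat _).Mor) }⟩

theorem head_self (w : Λ.Mor) (q : Fin k → ℕ) (hq : q ≤ Λ.d w) (h : Λ.d w = q) :
    Λ.head w q hq = w := by
  subst h
  exact (eq_head_tail (Λ.r_one (Λ.s w)).symm (Λ.comp_one w) hq).1

theorem seg_eq_of_comp {A B w : Λ.Mor} (h : Λ.s A = Λ.r B) (hc : Λ.comp A B h = w)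
    {p q : Fin k → ℕ} (hA : Λ.d A = p) (hw : Λ.d w = q) (hpq : p ≤ q) (hq : q ≤ Λ.d w) :
    Λ.seg w p q hpq hq = B := by
  subst hA
  have e := head_self w q hq hw
  unfold TopKGraph.seg
  exact (eq_head_tail h (hc.trans e.symm) _).2

theorem below_d_concat (f : Λ.Mor) (x : PathSpace Λ) (h : Λ.s f = x.r) :
    Below (Λ.d f) (concat f x h).deg := fun _ => le_self_add

/-- `f` is the initial segment of `f x`. -/
theorem concat_seg_zero (f : Λ.Mor) (x : PathSpace Λ) (h : Λ.s f = x.r) :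
    (concat f x h).seg 0 (Λ.d f) (fun _ => Nat.zero_le _) (below_d_concat f x h) = f := by
  refine (seg_eq_of_comp (A := Λ.one (Λ.r f)) (Λ.s_one _) (Λ.one_comp f) (Λ.d_one _) rfl
    (fun _ => Nat.zero_le _) le_rfl).symm.trans ?_ |>.symm
  exact (seg_comp f _ _ 0 (Λ.d f) (fun _ => Nat.zero_le _) le_rfl _).symm

/-- Removing the initial segment `f` of `f x` gives `x`. -/
theorem shift_concat (f : Λ.Mor) (x : PathSpace Λ) (h : Λ.s f = x.r) :
    shift (Λ.d f) (concat f x h) (below_d_concat f x h) = x := by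
  refine ext_seg ?_ ?_
  · funext i
    exact (ENat.addLECancellable_natCast _).add_tsub_cancel_left
  · intro p q hpq hq hq'
    have hp' := hq'.mono hpq
    have h1 : Λ.s f = Λ.r (x.seg 0 p (fun _ => Nat.zero_le _) hp') :=
      h.trans (r_path_seg _ _ _ _ _).symm
    have h2 : Λ.s (Λ.comp f _ h1) = Λ.r (x.seg p q hpq hq') := by
      rw [Λ.s_comp, s_path_seg, r_path_seg]
    have h3 : Λ.s f = Λ.r (x.seg 0 q (fun _ => Nat.zero_le _) hq') :=
      h.trans (r_path_seg _ _ _ _ _).symm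
    have hB := below_shift (below_d_concat f x h) hq
    have e0 : word f x h (Λ.d f + q) hB = Λ.comp f _ h3 :=
      comp_congr rfl (seg_congr x rfl (add_tsub_cancel_left _ _) _ _) _ _
    have e1 : Λ.comp (Λ.comp f _ h1) _ h2 = word f x h (Λ.d f + q) hB := by
      rw [e0, Λ.assoc]
      · exact comp_congr rfl (path_seg_comp x 0 p q _ hpq hq').symm _ _
    refine seg_eq_of_comp h2 e1 ?_ ?_ (add_le_add le_rfl hpq) (le_d_word f x h _ hB)
    · rw [Λ.d_comp, d_path_seg, tsub_zero]
    · rw [e0, Λ.d_comp, d_path_seg, tsub_zero]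

/-- A path is the concatenation of its initial segment of degree `n` and its shift by `n`. -/
theorem concat_shift (x : PathSpace Λ) (n : Fin k → ℕ) (hn : Below n x.deg)
    (h : Λ.s (x.seg 0 n (fun _ => Nat.zero_le _) hn) = (shift n x hn).r) :
    concat (x.seg 0 n (fun _ => Nat.zero_le _) hn) (shift n x hn) h = x := by
  have hd : Λ.d (x.seg 0 n (fun _ => Nat.zero_le _) hn) = n := by rw [d_path_seg, tsub_zero]
  refine ext_seg ?_ ?_
  · funext i
    change ((Λ.d (x.seg 0 n _ hn) i : ℕ) : ℕ∞) + (x.deg i - (n i : ℕ∞)) = x.deg i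
    rw [hd]
    exact add_tsub_cancel_of_le (hn i)
  · intro p q hpq hq hq'
    generalize hf : x.seg 0 n (fun _ => Nat.zero_le _) hn = f at *
    have hle : n ≤ n + (q - Λ.d f) := le_self_add
    have hN : Below (n + (q - Λ.d f)) x.deg := below_shift hn (below_sub hq)
    have hqN : q ≤ n + (q - Λ.d f) := by rw [hd]; exact le_add_tsub
    have hw : word f (shift n x hn) h q hq = x.seg 0 (n + (q - Λ.d f)) (fun _ => Nat.zero_le _) hN := by
      rw [path_seg_comp x 0 n _ (fun _ => Nat.zero_le _) hle hN]
      exact comp_congr hf.symm (seg_congr x (add_zero n) rfl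
        (add_le_add le_rfl fun _ => Nat.zero_le _) hN) _ _
    have hw2 : Λ.comp (x.seg 0 q (fun _ => Nat.zero_le _) hq') (x.seg q _ hqN hN)
        ((s_path_seg _ _ _ _ _).trans (r_path_seg _ _ _ _ _).symm) =
        word f (shift n x hn) h q hq := by
      rw [hw, path_seg_comp x 0 q _ (fun _ => Nat.zero_le _) hqN hN]
    have key : ∀ (w : Λ.Mor) (hqw : q ≤ Λ.d w), Λ.comp (x.seg 0 q (fun _ => Nat.zero_le _) hq')
        (x.seg q _ hqN hN) ((s_path_seg _ _ _ _ _).trans (r_path_seg _ _ _ _ _).symm) = w →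
        Λ.seg w p q hpq hqw = x.seg p q hpq hq' := by
      rintro w hqw rfl
      have hdq : Λ.d (x.seg 0 q (fun _ => Nat.zero_le _) hq') = q := by rw [d_path_seg, tsub_zero]
      rw [seg_comp _ _ _ p q hpq hdq.ge]
      refine seg_eq_of_comp _ (path_seg_comp x 0 p q (fun _ => Nat.zero_le _) hpq hq').symm
        ?_ hdq _ _
      rw [d_path_seg, tsub_zero]
    exact key _ _ hw2

end PathSpace

/-! ### Topological groupoids and Haar systems -/

/-- A groupoid: a small category with inverses. -/
structure SmallGroupoid extends SmallCat.{u, v} where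
  inv : Mor → Mor
  r_inv : ∀ f, r (inv f) = s f
  s_inv : ∀ f, s (inv f) = r f
  inv_comp : ∀ f, comp (inv f) f (s_inv f) = one (s f)
  comp_inv : ∀ f, comp f (inv f) (r_inv f).symm = one (r f)

namespace SmallGroupoid

/-- `G` is a topological groupoid: inversion, composition, range and source are continuous, and
the object set carries the topology of the unit space as a subspace of `G`. -/
structure IsTopologicalGroupoid (G : SmallGroupoid.{u, v}) [TopologicalSpace G.Obj]
    [TopologicalSpace G.Mor] : Prop where
  isEmbedding_one : IsEmbedding G.one
  continuous_r : Continuous G.r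
  continuous_s : Continuous G.s
  continuous_inv : Continuous G.inv
  continuous_comp : Continuous G.compMap

/-- `G` is `r`-discrete: its unit space is open. -/
def IsRDiscrete (G : SmallGroupoid.{u, v}) [TopologicalSpace G.Mor] : Prop :=
  IsOpen (Set.range G.one)

/-- The fibre `G^a` of morphisms with range `a`. -/
def rFiber (G : SmallGroupoid.{u, v}) (a : G.Obj) : Set G.Mor := {g | G.r g = a}

open Classical in
/-- A (left) Haar system on `G`: a family of Radon measures `ν a` on `G`, with support `G^a`, such
that integrals of functions in `C_c(G)` depend continuously on `a`, and which is invariant under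
left translation. -/
structure IsHaarSystem (G : SmallGroupoid.{u, v}) [TopologicalSpace G.Obj]
    [TopologicalSpace G.Mor] [MeasurableSpace G.Mor] (ν : G.Obj → Measure G.Mor) : Prop where
  regular : ∀ a, (ν a).Regular
  support_eq : ∀ a, (ν a).support = G.rFiber a
  continuous_integral : ∀ f : G.Mor → ℂ, Continuous f → HasCompactSupport f →
    Continuous fun a => ∫ g, f g ∂(ν a)
  left_invariant : ∀ f : G.Mor → ℂ, Continuous f → HasCompactSupport f → ∀ g : G.Mor,
    ∫ h, (if e : G.s g = G.r h then f (G.comp g h e) else 0) ∂(ν (G.s g)) = ∫ h, f h ∂(ν (G.r g))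

end SmallGroupoid

/-! ### The path groupoid -/

namespace PathSpace

variable {Λ : TopKGraph.{u, v} k}

/-- There are `p ≤ d(x)` and `q ≤ d(y)` in `ℕ^k` with `p - q = m` and `σ^p x = σ^q y`. -/
def ShiftEquiv (x : PathSpace Λ) (m : Fin k → ℤ) (y : PathSpace Λ) : Prop :=
  ∃ (p q : Fin k → ℕ) (hp : Below p x.deg) (hq : Below q y.deg),
    (∀ i, (p i : ℤ) - (q i : ℤ) = m i) ∧ shift p x hp = shift q y hq

theorem ShiftEquiv.refl (x : PathSpace Λ) : ShiftEquiv x 0 x :=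
  ⟨0, 0, below_zero _, below_zero _, fun i => by simp, rfl⟩

theorem ShiftEquiv.symm {x y : PathSpace Λ} {m : Fin k → ℤ} (h : ShiftEquiv x m y) :
    ShiftEquiv y (-m) x := by
  obtain ⟨p, q, hp, hq, hm, e⟩ := h
  exact ⟨q, p, hq, hp, fun i => by rw [Pi.neg_apply, ← hm i]; ring, e.symm⟩

theorem below_add {m : Fin k → ℕ∞} {n a : Fin k → ℕ} (h : Below (n + a) m) :
    Below a (fun i => m i - (n i : ℕ∞)) := fun i => by
  have h1 := h i
  simp only [Pi.add_apply, Nat.cast_add] at h1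
  exact ENat.le_sub_of_add_le_left (ENat.natCast_ne_top _) h1

theorem extend_shift_eq {x y : PathSpace Λ} {p q : Fin k → ℕ} {hp : Below p x.deg}
    {hq : Below q y.deg} (e : shift p x hp = shift q y hq) (a : Fin k → ℕ)
    (hqa : Below (q + a) y.deg) :
    ∃ hpa : Below (p + a) x.deg, shift (p + a) x hpa = shift (q + a) y hqa := by
  have ha : Below a (shift q y hq).deg := below_add hqa
  have ha' : Below a (shift p x hp).deg := by rw [e]; exact ha
  refine ⟨below_shift hp ha', ?_⟩
  rw [← shift_shift x p a hp ha', ← shift_shift y q a hq ha]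
  congr 1

theorem ShiftEquiv.trans {x y z : PathSpace Λ} {m n : Fin k → ℤ} (h : ShiftEquiv x m y)
    (h' : ShiftEquiv y n z) : ShiftEquiv x (m + n) z := by
  obtain ⟨p, q, hp, hq, hm, e⟩ := h
  obtain ⟨p', q', hp', hq', hn, e'⟩ := h'
  have hN : Below (q ⊔ p') y.deg := fun i => by
    rcases le_total (q i) (p' i) with hh | hh
    · simpa [hh] using hp' i
    · simpa [hh] using hq i
  have e1 : q + (q ⊔ p' - q) = q ⊔ p' := add_tsub_cancel_of_le le_sup_left
  have e2 : p' + (q ⊔ p' - p') = q ⊔ p' := add_tsub_cancel_of_le le_sup_right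
  obtain ⟨h1, k1⟩ := extend_shift_eq e (q ⊔ p' - q) (by rw [e1]; exact hN)
  obtain ⟨h2, k2⟩ := extend_shift_eq e'.symm (q ⊔ p' - p') (by rw [e2]; exact hN)
  refine ⟨_, _, h1, h2, fun i => ?_, k1.trans (Eq.trans ?_ k2.symm)⟩
  · have := hm i; have := hn i
    have g1 := congrFun e1 i; have g2 := congrFun e2 i
    simp only [Pi.add_apply, Pi.sub_apply, Pi.sup_apply] at g1 g2 ⊢
    omega
  · congr 1
    rw [e1, e2]

/-- The triples `(x, m, y)` with `σ^p x = σ^q y`, `p - q = m`, are the triples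
`(f z, d(f) - d(g), g z)`. -/
theorem shiftEquiv_iff (x : PathSpace Λ) (m : Fin k → ℤ) (y : PathSpace Λ) :
    ShiftEquiv x m y ↔ ∃ (f g : Λ.Mor) (z : PathSpace Λ) (h₁ : Λ.s f = z.r) (h₂ : Λ.s g = z.r),
      (∀ i, (Λ.d f i : ℤ) - (Λ.d g i : ℤ) = m i) ∧ x = concat f z h₁ ∧ y = concat g z h₂ := by
  constructor
  · rintro ⟨p, q, hp, hq, hm, e⟩
    have r_shift : ∀ (w : PathSpace Λ) n hn, (shift n w hn).r = w.vertex n hn := by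
      intro w n hn
      change w.2.obj _ = w.2.obj _
      exact congrArg w.2.obj (Subtype.ext (add_zero n))
    have h₁ : Λ.s (x.seg 0 p (fun _ => Nat.zero_le _) hp) = (shift p x hp).r := by
      rw [s_path_seg, r_shift]
    have h₂ : Λ.s (y.seg 0 q (fun _ => Nat.zero_le _) hq) = (shift q y hq).r := by
      rw [s_path_seg, r_shift]
    refine ⟨_, _, shift p x hp, h₁, h₂.trans (congrArg r e.symm), fun i => ?_,
      (concat_shift x p hp h₁).symm, ?_⟩
    · rw [d_path_seg, d_path_seg]; simpa using hm i
    · simp only [e]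
      exact (concat_shift y q hq h₂).symm
  · rintro ⟨f, g, z, h₁, h₂, hm, rfl, rfl⟩
    exact ⟨_, _, below_d_concat _ _ _, below_d_concat _ _ _, hm,
      (shift_concat _ _ _).trans (shift_concat _ _ _).symm⟩

end PathSpace

/-- The path groupoid `G_Λ`: objects are the paths in `X_Λ`, morphisms the triples `(x, m, y)`. -/
def pathGroupoid (Λ : TopKGraph.{u, v} k) : SmallGroupoid.{max u v, max u v} where
  Obj := PathSpace Λ
  Mor := {g : PathSpace Λ × (Fin k → ℤ) × PathSpace Λ // PathSpace.ShiftEquiv g.1 g.2.1 g.2.2}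
  r g := g.1.1
  s g := g.1.2.2
  one x := ⟨(x, 0, x), .refl x⟩
  comp g h e := ⟨(g.1.1, g.1.2.1 + h.1.2.1, h.1.2.2), g.2.trans (by rw [e]; exact h.2)⟩
  r_one _ := rfl
  s_one _ := rfl
  r_comp _ _ _ := rfl
  s_comp _ _ _ := rfl
  one_comp g := Subtype.ext (by simp)
  comp_one g := Subtype.ext (by simp)
  assoc f g h _ _ := Subtype.ext (by simp [add_assoc])
  inv g := ⟨(g.1.2.2, -g.1.2.1, g.1.1), g.2.symm⟩
  r_inv _ := rfl
  s_inv _ := rfl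
  inv_comp g := Subtype.ext (by simp)
  comp_inv g := Subtype.ext (by simp)

variable (Λ : TopKGraph.{u, v} k)

/-- The set `U *_s V` of pairs in `U × V` with a common source. -/
def starS (U V : Set Λ.Mor) : Set (Λ.Mor × Λ.Mor) := {p | p.1 ∈ U ∧ p.2 ∈ V ∧ Λ.s p.1 = Λ.s p.2}

/-- The set `Z(F, m)` of all `(λ x, d(λ) - d(μ), μ x)` with `(λ, μ) ∈ F` and `d(λ) - d(μ) = m`. -/
def cylinder (F : Set (Λ.Mor × Λ.Mor)) (m : Fin k → ℤ) : Set (pathGroupoid Λ).Mor :=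
  {g | ∃ p ∈ F, ∃ (x : PathSpace Λ) (h₁ : Λ.s p.1 = x.r) (h₂ : Λ.s p.2 = x.r),
    (∀ i, (Λ.d p.1 i : ℤ) - (Λ.d p.2 i : ℤ) = m i) ∧
    g.1 = (PathSpace.concat p.1 x h₁, m, PathSpace.concat p.2 x h₂)}

/-- The family of sets `Z(U *_s V, m) ∩ Z(F, m)^c`, with `U, V ⊆ Λ` open and `F ⊆ Λ *_s Λ`
compact. -/
def basicSets : Set (Set (pathGroupoid Λ).Mor) :=
  {S | ∃ (m : Fin k → ℤ) (U V : Set Λ.Mor) (F : Set (Λ.Mor × Λ.Mor)),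
    IsOpen U ∧ IsOpen V ∧ F ⊆ starS Λ Set.univ Set.univ ∧ IsCompact F ∧
    S = cylinder Λ (starS Λ U V) m ∩ (cylinder Λ F m)ᶜ}

/-- The topology on `G_Λ` generated by the sets `Z(U *_s V, m) ∩ Z(F, m)^c`. -/
instance : TopologicalSpace (pathGroupoid Λ).Mor := TopologicalSpace.generateFrom (basicSets Λ)

/-- The object set `X_Λ` carries the topology of the unit space of `G_Λ`. -/
instance : TopologicalSpace (pathGroupoid Λ).Obj :=
  TopologicalSpace.induced (pathGroupoid Λ).one inferInstance

/-- `G_Λ` carries its Borel `σ`-algebra. -/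
instance : MeasurableSpace (pathGroupoid Λ).Mor := borel _

instance : BorelSpace (pathGroupoid Λ).Mor := ⟨rfl⟩

end KGraph

/-! An element g of G_Λ is encoded by its cocycle value together with its related pairs (a, b),
those with g = (az, d(a) - d(b), bz) for some path z; this is `Rel g a b`. The topology of G_Λ is of
hit-or-miss type on these sets of pairs: Z(U *_s V, m) asks for a related pair in U × V, and the
complement of Z(F, m) forbids related pairs in F. Hence convergence g_i → g amounts to eventually
equal cocycle values together with the statement that the related pairs of g are exactly the limits
of related pairs of the g_i (`Rel.limRel`, `LimRel.rel`, and for ultrafilters the converse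
`tendsto_of_limRel_iff`). Since g is recovered from its cocycle value and its related pairs
(`ext_rel`), limits are unique.

The crux is that Z(F, m) is compact when F is compact. An ultrafilter on Z(F, m) yields a limit pair
(a, b) in F. The finite paths α for which (aα, bα) is again a limit pair are closed under initial
segments, because factorization is continuous and s is locally injective, and under minimal common
extensions, because compact alignment lets such extensions converge (`LimPre.join`). Such a family
is the set of initial segments of a path z (`IsPathFilter.path`), and the ultrafilter converges to
(az, m, bz). Local compactness follows by taking F to be the pairs with common source in a product
of compact neighbourhoods.

The structure maps are treated by the same ultrafilter criterion. Since s is a local homeomorphism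
on Λ, the range map of G_Λ is open and locally injective and the unit space is open; fibre sums of a
compactly supported continuous function are then locally finite sums along local sections of r,
which gives the Haar system. -/

namespace KGraph

/-! ### Composition in Λ as a relation -/

namespace TopKGraph

variable {k : ℕ} {Λ : TopKGraph.{u, v} k}

/-- `c` is the composite `a b`. -/
def IsComp (a b c : Λ.Mor) : Prop := ∃ h : Λ.s a = Λ.r b, Λ.comp a b h = c

theorem exists_isComp {a b : Λ.Mor} (h : Λ.s a = Λ.r b) : ∃ c, IsComp a b c := ⟨_, h, rfl⟩

theorem exists_isComp_of_le {c : Λ.Mor} {m : Fin k → ℕ} (h : m ≤ Λ.d c) :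
    ∃ a b, IsComp a b c ∧ Λ.d a = m :=
  ⟨_, _, ⟨s_head c m h, head_comp_tail c m h⟩, d_head c m h⟩

theorem isComp_one (a : Λ.Mor) : IsComp a (Λ.one (Λ.s a)) a := ⟨_, Λ.comp_one a⟩

namespace IsComp

variable {a b c a' b' c' : Λ.Mor}

theorem s_eq (h : IsComp a b c) : Λ.s c = Λ.s b := by
  obtain ⟨h, rfl⟩ := h; exact Λ.s_comp _ _ _

theorem d_eq (h : IsComp a b c) : Λ.d c = Λ.d a + Λ.d b := by
  obtain ⟨h, rfl⟩ := h; exact Λ.d_comp _ _ _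

theorem le_d (h : IsComp a b c) : Λ.d a ≤ Λ.d c := h.d_eq ▸ le_self_add

theorem unique (h : IsComp a b c) (h' : IsComp a b c') : c = c' := by
  obtain ⟨h, rfl⟩ := h; exact h'.2

theorem factor_unique (h : IsComp a b c) (h' : IsComp a' b' c) (hd : Λ.d a = Λ.d a') :
    a = a' ∧ b = b' := by
  obtain ⟨h, rfl⟩ := h
  obtain ⟨h', e⟩ := h'
  exact TopKGraph.factor_unique h h' e.symm hd

end IsComp

theorem tail_zero (f : Λ.Mor) (h : 0 ≤ Λ.d f) : Λ.tail f 0 h = f := by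
  have := eq_head_tail (Λ.s_one (Λ.r f)) (Λ.one_comp f) (by rw [Λ.d_one]; exact h)
  simpa only [Λ.d_one] using this.2

end TopKGraph

/-! ### Concatenation and initial segments of paths, as relations -/

namespace PathSpace

open TopKGraph

variable {k : ℕ} {Λ : TopKGraph.{u, v} k}

/-- `x` is the concatenation `a z`. -/
def IsConcat (a : Λ.Mor) (z x : PathSpace Λ) : Prop := ∃ h : Λ.s a = z.r, x = concat a z h

/-- `a` is an initial segment of `x`. -/
def Pre (a : Λ.Mor) (x : PathSpace Λ) : Prop := ∃ z, IsConcat a z x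

theorem exists_isConcat {a : Λ.Mor} {z : PathSpace Λ} (h : Λ.s a = z.r) : ∃ x, IsConcat a z x :=
  ⟨_, h, rfl⟩

theorem r_shift (w : PathSpace Λ) (n) (hn) : (shift n w hn).r = w.vertex n hn :=
  congrArg w.2.obj (Subtype.ext (add_zero n))

theorem isConcat_seg_shift (x : PathSpace Λ) (n : Fin k → ℕ) (hn : Below n x.deg) :
    IsConcat (x.seg 0 n (fun _ => Nat.zero_le _) hn) (shift n x hn) x := by
  have h : Λ.s (x.seg 0 n (fun _ => Nat.zero_le _) hn) = (shift n x hn).r := by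
    rw [s_path_seg, r_shift]
  exact ⟨h, (concat_shift x n hn h).symm⟩

theorem exists_isConcat_of_below {x : PathSpace Λ} {n : Fin k → ℕ} (hn : Below n x.deg) :
    ∃ a z, IsConcat a z x ∧ Λ.d a = n :=
  ⟨_, _, isConcat_seg_shift x n hn, by rw [d_path_seg, tsub_zero]⟩

theorem seg_zero_eq (x : PathSpace Λ) {n n' : Fin k → ℕ} (e : n = n') (hn : Below n x.deg)
    (hn' : Below n' x.deg) :
    x.seg 0 n (fun _ => Nat.zero_le _) hn = x.seg 0 n' (fun _ => Nat.zero_le _) hn' := by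
  subst e; rfl

theorem shift_congr (x : PathSpace Λ) {n n' : Fin k → ℕ} (e : n = n') (hn : Below n x.deg)
    (hn' : Below n' x.deg) : shift n x hn = shift n' x hn' := by
  subst e; rfl

namespace IsConcat

variable {a b c a' : Λ.Mor} {x y z w z' : PathSpace Λ}

theorem s_eq (h : IsConcat a z x) : Λ.s a = z.r := h.1

theorem below (h : IsConcat a z x) : Below (Λ.d a) x.deg := by
  obtain ⟨h, rfl⟩ := h; exact below_d_concat _ _ _

theorem seg_eq (h : IsConcat a z x) : x.seg 0 (Λ.d a) (fun _ => Nat.zero_le _) h.below = a := by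
  obtain ⟨h, rfl⟩ := h; exact concat_seg_zero _ _ _

theorem shift_eq (h : IsConcat a z x) : shift (Λ.d a) x h.below = z := by
  obtain ⟨h, rfl⟩ := h; exact shift_concat _ _ _

theorem r_eq (h : IsConcat a z x) : Λ.r a = x.r := by
  rw [← h.seg_eq, r_path_seg]; rfl

theorem unique (h : IsConcat a z x) (h' : IsConcat a z y) : x = y := by
  obtain ⟨_, rfl⟩ := h; obtain ⟨_, rfl⟩ := h'; rfl

theorem eq_of_d_eq (h : IsConcat a z x) (h' : IsConcat a' z' x) (hd : Λ.d a = Λ.d a') :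
    a = a' ∧ z = z' := by
  refine ⟨?_, ?_⟩
  · rw [← h.seg_eq, ← h'.seg_eq]; exact seg_zero_eq x hd _ _
  · rw [← h.shift_eq, ← h'.shift_eq]; exact shift_congr x hd _ _

/-- Cutting x at d(a) factors its initial segment c with first factor of degree d(a); unique
factorization identifies the two pieces with a and b. -/
theorem split (hc : IsComp a b c) (h : IsConcat c z x) :
    ∃ w, IsConcat b z w ∧ IsConcat a w x := by
  have hd := hc.d_eq
  have hB : Below (Λ.d a) x.deg := h.below.mono hc.le_d
  have hf : IsComp (x.seg 0 (Λ.d a) (fun _ => Nat.zero_le _) hB)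
      (x.seg (Λ.d a) (Λ.d c) hc.le_d h.below) c :=
    ⟨_, (path_seg_comp x 0 (Λ.d a) (Λ.d c) (fun _ => Nat.zero_le _) hc.le_d h.below).symm.trans
      h.seg_eq⟩
  obtain ⟨e1, e2⟩ := hf.factor_unique hc (by rw [d_path_seg, tsub_zero])
  have hB' : Below (Λ.d b) (shift (Λ.d a) x hB).deg :=
    below_add (by rw [← hd]; exact h.below)
  have h1 := isConcat_seg_shift x (Λ.d a) hB
  have h2 := isConcat_seg_shift (shift (Λ.d a) x hB) (Λ.d b) hB'
  rw [e1] at h1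
  have e3 : (shift (Λ.d a) x hB).seg 0 (Λ.d b) (fun _ => Nat.zero_le _) hB' = b := by
    exact (seg_congr x (add_zero _) hd.symm (add_le_add le_rfl fun _ => Nat.zero_le _)
      (hd ▸ h.below)).trans e2
  rw [e3, shift_shift x _ _ hB hB' (by rw [← hd]; exact h.below),
    shift_congr x hd.symm _ h.below, h.shift_eq] at h2
  exact ⟨_, h2, h1⟩

theorem comp (hc : IsComp a b c) (h : IsConcat b z w) (h' : IsConcat a w x) : IsConcat c z x := by
  obtain ⟨x', hx'⟩ := exists_isConcat (hc.s_eq.trans h.s_eq)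
  obtain ⟨w', h1, h2⟩ := split hc hx'
  obtain rfl := h.unique h1
  obtain rfl := h'.unique h2
  exact hx'

theorem of_comp (hc : IsComp a b c) (h : IsConcat a w x) (h' : IsConcat c z x) :
    IsConcat b z w := by
  obtain ⟨w', h1, h2⟩ := split hc h'
  rwa [(h.eq_of_d_eq h2 rfl).2]

/-- Two initial segments of a path have a common extension along that path. -/
theorem join (h : IsConcat a z x) (h' : IsConcat a' z' x) :
    ∃ α α' c w, IsComp a α c ∧ IsComp a' α' c ∧ Λ.d c = Λ.d a ⊔ Λ.d a' ∧ IsConcat c w x := by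
  have hN : Below (Λ.d a ⊔ Λ.d a') x.deg := fun i => by
    have h1 := h.below i
    have h2 := h'.below i
    rcases le_total (Λ.d a i) (Λ.d a' i) with hh | hh
    · simpa [hh] using h2
    · simpa [hh] using h1
  obtain ⟨c, w, hc, hd⟩ := exists_isConcat_of_below hN
  obtain ⟨a₁, α, h1, e1⟩ := exists_isComp_of_le (c := c) (m := Λ.d a) (hd ▸ le_sup_left)
  obtain ⟨a₂, α', h2, e2⟩ := exists_isComp_of_le (c := c) (m := Λ.d a') (hd ▸ le_sup_right)
  obtain ⟨_, -, k1⟩ := split h1 hc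
  obtain ⟨_, -, k2⟩ := split h2 hc
  obtain rfl := (k1.eq_of_d_eq h e1).1
  obtain rfl := (k2.eq_of_d_eq h' e2).1
  exact ⟨α, α', c, w, h1, h2, hd, hc⟩

end IsConcat

theorem exists_pre (x : PathSpace Λ) : ∃ a, Pre a x := by
  obtain ⟨a, z, h, -⟩ := exists_isConcat_of_below (below_zero x.deg)
  exact ⟨a, z, h⟩

theorem Pre.of_comp {a b c : Λ.Mor} {x : PathSpace Λ} (hc : IsComp a b c) (h : Pre c x) :
    Pre a x := by
  obtain ⟨z, h⟩ := h
  obtain ⟨w, -, h⟩ := h.split hc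
  exact ⟨w, h⟩

theorem Pre.eq_of_d_eq {a a' : Λ.Mor} {x : PathSpace Λ} (h : Pre a x) (h' : Pre a' x)
    (hd : Λ.d a = Λ.d a') : a = a' := by
  obtain ⟨z, h⟩ := h
  obtain ⟨z', h'⟩ := h'
  exact (h.eq_of_d_eq h' hd).1

theorem Pre.join {a a' : Λ.Mor} {x : PathSpace Λ} (h : Pre a x) (h' : Pre a' x) :
    ∃ α α' c, IsComp a α c ∧ IsComp a' α' c ∧ Λ.d c = Λ.d a ⊔ Λ.d a' ∧ Pre c x := by
  obtain ⟨z, h⟩ := h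
  obtain ⟨z', h'⟩ := h'
  obtain ⟨α, α', c, w, h1, h2, h3, h4⟩ := h.join h'
  exact ⟨α, α', c, h1, h2, h3, w, h4⟩

/-- The i-th coordinate of d(x) is detected by the initial segments of x whose degree is supported
at i. -/
theorem below_deg_of_pre {x y : PathSpace Λ} (h : ∀ a, Pre a x → Pre a y) : x.deg ≤ y.deg := by
  intro i
  refine ENat.forall_natCast_le_iff_le.mp fun n hn => ?_
  have hB : Below (Pi.single i n) x.deg := fun j => by
    by_cases hj : j = i
    · subst hj; simpa using hn
    · simp [Pi.single_eq_of_ne hj]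
  obtain ⟨a, z, ha, hd⟩ := exists_isConcat_of_below hB
  obtain ⟨z', hz'⟩ := h a ⟨z, ha⟩
  have := hz'.below i
  rw [hd] at this
  simpa using this

/-- A path is determined by its initial segments. -/
theorem ext_pre {x y : PathSpace Λ} (h : ∀ a, Pre a x ↔ Pre a y) : x = y := by
  refine ext_seg (le_antisymm (below_deg_of_pre fun a => (h a).1)
    (below_deg_of_pre fun a => (h a).2)) ?_
  have key : ∀ q hq hq', x.seg 0 q (fun _ => Nat.zero_le _) hq =
      y.seg 0 q (fun _ => Nat.zero_le _) hq' := fun q hq hq' =>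
    ((h _).1 ⟨_, isConcat_seg_shift x q hq⟩).eq_of_d_eq ⟨_, isConcat_seg_shift y q hq'⟩
      (by rw [d_path_seg, d_path_seg])
  intro p q hpq hq hq'
  have h1 := path_seg_comp x 0 p q (fun _ => Nat.zero_le _) hpq hq
  have h2 := path_seg_comp y 0 p q (fun _ => Nat.zero_le _) hpq hq'
  rw [key q hq hq'] at h1
  -- x(0,p) x(p,q) and y(0,p) y(p,q) are two factorizations of one finite path with first factors of
  -- degree p.
  exact (TopKGraph.factor_unique _ _ (h1.symm.trans h2)
    (by rw [d_path_seg, d_path_seg])).2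

/-! ### Reconstructing a path from its set of initial segments -/

/-- A nonempty set of finite paths which is closed under initial segments and minimal common
extensions. -/
structure IsPathFilter (P : Set Λ.Mor) : Prop where
  nonempty : P.Nonempty
  of_comp : ∀ {a b c}, IsComp a b c → c ∈ P → a ∈ P
  join : ∀ {a a'}, a ∈ P → a' ∈ P →
    ∃ c ∈ P, Λ.d c = Λ.d a ⊔ Λ.d a' ∧ (∃ α, IsComp a α c) ∧ ∃ α', IsComp a' α' c

namespace IsPathFilter

variable {P : Set Λ.Mor}

/-- The supremum of the degrees of the elements of `P`. -/
noncomputable def deg (P : Set Λ.Mor) : Fin k → ℕ∞ := fun i => ⨆ a ∈ P, (Λ.d a i : ℕ∞)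

theorem eq_of_d_eq (hP : IsPathFilter P) {a a' : Λ.Mor} (h : a ∈ P) (h' : a' ∈ P)
    (hd : Λ.d a = Λ.d a') : a = a' := by
  obtain ⟨c, -, -, ⟨α, h1⟩, ⟨α', h2⟩⟩ := hP.join h h'
  exact (h1.factor_unique h2 hd).1

/-- Each coordinate of n is reached by some element, as otherwise the supremum would be smaller.
Joining these elements over the finitely many coordinates gives one of degree at least n, which is
then truncated. -/
theorem exists_d_eq (hP : IsPathFilter P) {n : Fin k → ℕ} (hn : Below n (deg P)) :
    ∃ a ∈ P, Λ.d a = n := by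
  have h1 : ∀ i, ∃ a ∈ P, n i ≤ Λ.d a i := by
    intro i
    by_contra! hcon
    obtain ⟨a₀, ha₀⟩ := hP.nonempty
    -- Positivity ensures that the truncated subtraction in n i - 1 is a genuine one.
    have hpos : 0 < n i := (Nat.zero_le _).trans_lt (hcon a₀ ha₀)
    have : deg P i ≤ ((n i - 1 : ℕ) : ℕ∞) := iSup₂_le fun a ha => by
      have := hcon a ha
      exact_mod_cast (by omega : Λ.d a i ≤ n i - 1)
    have h2 : n i ≤ n i - 1 := by exact_mod_cast (hn i).trans this
    omega
  have h2 : ∀ s : Finset (Fin k), ∃ a ∈ P, ∀ i ∈ s, n i ≤ Λ.d a i := by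
    intro s
    induction s using Finset.induction_on with
    | empty => obtain ⟨a₀, ha₀⟩ := hP.nonempty; exact ⟨a₀, ha₀, by simp⟩
    | insert j s _ ih =>
      obtain ⟨a, ha, has⟩ := ih
      obtain ⟨b, hb, hbj⟩ := h1 j
      obtain ⟨c, hc, hd, -, -⟩ := hP.join ha hb
      refine ⟨c, hc, fun i hi => ?_⟩
      rw [hd, Pi.sup_apply]
      rcases Finset.mem_insert.mp hi with rfl | hi
      · exact hbj.trans le_sup_right
      · exact (has i hi).trans le_sup_left
  obtain ⟨c, hc, hcn⟩ := h2 Finset.univ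
  obtain ⟨a, b, hab, hd⟩ := exists_isComp_of_le (c := c) (m := n) fun i => hcn i (Finset.mem_univ i)
  exact ⟨a, hP.of_comp hab hc, hd⟩

/-- The initial segment of degree `n` of the path given by `P`. -/
noncomputable def elt (hP : IsPathFilter P) (n : Fin k → ℕ) (hn : Below n (deg P)) : Λ.Mor :=
  (hP.exists_d_eq hn).choose

theorem elt_mem (hP : IsPathFilter P) (n) (hn : Below n (deg P)) : hP.elt n hn ∈ P :=
  (hP.exists_d_eq hn).choose_spec.1

theorem d_elt (hP : IsPathFilter P) (n) (hn : Below n (deg P)) : Λ.d (hP.elt n hn) = n :=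
  (hP.exists_d_eq hn).choose_spec.2

/-- An element of `P` is determined by its degree, so the choices made in `elt` are automatically
coherent. -/
theorem head_elt (hP : IsPathFilter P) (p q) (hpq : p ≤ q) (hq : Below q (deg P)) :
    Λ.head (hP.elt q hq) p (hpq.trans (hP.d_elt q hq).ge) = hP.elt p (hq.mono hpq) := by
  refine hP.eq_of_d_eq (hP.of_comp ⟨_, head_comp_tail _ p _⟩ (hP.elt_mem q hq)) (hP.elt_mem _ _) ?_
  rw [d_head, d_elt]

theorem seg_elt (hP : IsPathFilter P) (p q t) (hpq : p ≤ q) (hqt : q ≤ t)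
    (ht : Below t (deg P)) :
    Λ.seg (hP.elt t ht) p q hpq (hqt.trans (hP.d_elt t ht).ge) =
      Λ.seg (hP.elt q (ht.mono hqt)) p q hpq (hP.d_elt _ _).ge := by
  unfold TopKGraph.seg
  congr 1
  rw [head_elt hP q t hqt ht, head_elt hP q q le_rfl]

/-- The path whose initial segments are the elements of `P`. -/
noncomputable def path (hP : IsPathFilter P) : PathSpace Λ :=
  ⟨deg P,
    { obj := fun a => Λ.s (hP.elt a.1 a.2)
      mor := fun e => Λ.seg (hP.elt e.1.2 e.2.2) e.1.1 e.1.2 e.2.1 (hP.d_elt _ _).ge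
      map_r := fun e => by
        rw [r_seg]
        exact congrArg Λ.s (head_elt hP _ _ e.2.1 e.2.2)
      map_s := fun e => by
        rw [s_seg]
        exact congrArg Λ.s (head_elt hP _ _ le_rfl e.2.2)
      map_one := fun a => by
        have h0 := eq_one_of_d_eq_zero (f := Λ.seg (hP.elt a.1 a.2) a.1 a.1 le_rfl
          (hP.d_elt _ _).ge) (by rw [d_seg, tsub_self])
        rw [s_seg, head_elt hP _ _ le_rfl a.2] at h0
        exact h0
      map_comp := fun e g hh => by
        obtain ⟨⟨p, q⟩, hpq, hq⟩ := e
        obtain ⟨⟨q', t⟩, hqt, ht⟩ := g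
        obtain rfl : q = q' := congrArg Subtype.val hh
        refine Eq.trans (seg_comp_seg (hP.elt t ht) p q t hpq hqt (hP.d_elt _ _).ge
          ((s_seg _ _ _ _ _).trans (r_seg _ _ _ _ _).symm)).symm ?_
        exact comp_congr (seg_elt hP p q t hpq hqt ht) rfl _ _
      map_d := fun e => d_seg _ _ _ _ _
      continuous_obj := continuous_of_discreteTopology (α := (omegaCat _).Obj)
      continuous_mor := continuous_of_discreteTopology (α := (omegaCat _).Mor) }⟩

theorem path_seg_zero (hP : IsPathFilter P) (n) (hn : Below n (deg P)) :
    hP.path.seg 0 n (fun _ => Nat.zero_le _) hn = hP.elt n hn := by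
  exact (tail_zero _ fun _ => Nat.zero_le _).trans (head_elt hP n n le_rfl hn)

theorem pre_path_iff (hP : IsPathFilter P) (a : Λ.Mor) : Pre a hP.path ↔ a ∈ P := by
  constructor
  · rintro ⟨z, h⟩
    rw [← h.seg_eq]
    rw [path_seg_zero hP _ h.below]
    exact hP.elt_mem _ _
  · intro ha
    have hB : Below (Λ.d a) (deg P) := fun i =>
      le_iSup₂ (f := fun (a : Λ.Mor) (_ : a ∈ P) => (Λ.d a i : ℕ∞)) a ha
    have h1 := isConcat_seg_shift hP.path (Λ.d a) hB
    rw [path_seg_zero hP _ hB, hP.eq_of_d_eq (hP.elt_mem _ hB) ha (hP.d_elt _ _)] at h1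
    exact ⟨_, h1⟩

end IsPathFilter

end PathSpace

/-! ### Groupoid elements described by their related pairs -/

open TopKGraph PathSpace Filter

variable {k : ℕ} {Λ : TopKGraph.{u, v} k} {ι : Type*} {l : Filter ι}

/-- `g = (a z, d(a) - d(b), b z)` for some path `z`. -/
def Rel (g : (pathGroupoid Λ).Mor) (a b : Λ.Mor) : Prop :=
  ∃ z, IsConcat a z g.1.1 ∧ IsConcat b z g.1.2.2 ∧ ∀ i, (Λ.d a i : ℤ) - (Λ.d b i : ℤ) = g.1.2.1 i

theorem mem_cylinder_iff {F : Set (Λ.Mor × Λ.Mor)} {m : Fin k → ℤ} {g : (pathGroupoid Λ).Mor} :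
    g ∈ cylinder Λ F m ↔ g.1.2.1 = m ∧ ∃ p ∈ F, Rel g p.1 p.2 := by
  constructor
  · rintro ⟨p, hp, z, h₁, h₂, hm, e⟩
    refine ⟨by rw [e], p, hp, z, ⟨h₁, by rw [e]⟩, ⟨h₂, by rw [e]⟩, by rw [e]; exact hm⟩
  · rintro ⟨rfl, p, hp, z, ⟨h₁, e₁⟩, ⟨h₂, e₂⟩, hm⟩
    exact ⟨p, hp, z, h₁, h₂, hm, Prod.ext e₁ (Prod.ext rfl e₂)⟩

theorem exists_rel (g : (pathGroupoid Λ).Mor) : ∃ a b, Rel g a b := by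
  obtain ⟨a, b, z, h₁, h₂, hm, e₁, e₂⟩ := (shiftEquiv_iff _ _ _).1 g.2
  exact ⟨a, b, z, ⟨h₁, e₁⟩, ⟨h₂, e₂⟩, hm⟩

/-- There is a groupoid element `(a z, d(a) - d(b), b z)` whenever `s(a) = s(b) = r(z)`. -/
theorem exists_rel_mk {a b : Λ.Mor} {z : PathSpace Λ} (ha : Λ.s a = z.r) (hb : Λ.s b = z.r) :
    ∃ g : (pathGroupoid Λ).Mor, IsConcat a z g.1.1 ∧ IsConcat b z g.1.2.2 ∧ Rel g a b ∧
      g.1.2.1 = fun i => (Λ.d a i : ℤ) - (Λ.d b i : ℤ) :=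
  ⟨⟨(concat a z ha, fun i => (Λ.d a i : ℤ) - (Λ.d b i : ℤ), concat b z hb),
    (shiftEquiv_iff _ _ _).2 ⟨a, b, z, ha, hb, fun _ => rfl, rfl, rfl⟩⟩,
    ⟨ha, rfl⟩, ⟨hb, rfl⟩, ⟨z, ⟨ha, rfl⟩, ⟨hb, rfl⟩, fun _ => rfl⟩, rfl⟩

namespace Rel

variable {g h : (pathGroupoid Λ).Mor} {a b c e α a' b' : Λ.Mor}

theorem s_eq (hg : Rel g a b) : Λ.s a = Λ.s b := by
  obtain ⟨z, h1, h2, -⟩ := hg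
  exact h1.s_eq.trans h2.s_eq.symm

theorem sub_eq (hg : Rel g a b) (i) : (Λ.d a i : ℤ) - (Λ.d b i : ℤ) = g.1.2.1 i := by
  obtain ⟨z, -, -, h⟩ := hg; exact h i

theorem pre_left (hg : Rel g a b) : Pre a g.1.1 := by
  obtain ⟨z, h1, -, -⟩ := hg; exact ⟨z, h1⟩

theorem pre_right (hg : Rel g a b) : Pre b g.1.2.2 := by
  obtain ⟨z, -, h2, -⟩ := hg; exact ⟨z, h2⟩

theorem d_right (hg : Rel g a b) (hh : Rel h a' b') (hm : g.1.2.1 = h.1.2.1)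
    (hd : Λ.d a = Λ.d a') : Λ.d b = Λ.d b' := by
  funext i
  have h1 := hg.sub_eq i
  have h2 := hh.sub_eq i
  rw [hm] at h1
  rw [hd] at h1
  omega

/-- The cocycle value turns d(a) into d(b), and an initial segment of a given path is determined by
its degree. This rigidity makes all later choices of related pairs unique. -/
theorem eq_of_d_eq (hg : Rel g a b) (hg' : Rel g a' b') (hd : Λ.d a = Λ.d a') :
    a = a' ∧ b = b' :=
  ⟨hg.pre_left.eq_of_d_eq hg'.pre_left hd,
    hg.pre_right.eq_of_d_eq hg'.pre_right (hg.d_right hg' rfl hd)⟩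

/-- If g = (az, m, bz) and aα begins az, then α begins z, so bα begins bz with the same remainder.
-/
theorem extend (hg : Rel g a b) (hc : IsComp a α c) (hp : Pre c g.1.1) :
    ∃ e, IsComp b α e ∧ Rel g c e := by
  obtain ⟨z, h1, h2, hm⟩ := hg
  obtain ⟨w, hw⟩ := hp
  have hα := IsConcat.of_comp hc h1 hw
  obtain ⟨e, he⟩ := exists_isComp (h2.s_eq.trans hα.r_eq.symm)
  refine ⟨e, he, w, hw, IsConcat.comp he hα h2, fun i => ?_⟩
  have h3 := congrFun hc.d_eq i
  have h4 := congrFun he.d_eq i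
  have h5 := hm i
  simp only [Pi.add_apply] at h3 h4
  omega

theorem restrict (hg : Rel g c e) (hc : IsComp a α c) (he : IsComp b α e) : Rel g a b := by
  obtain ⟨z, h1, h2, hm⟩ := hg
  obtain ⟨w, k1, k2⟩ := IsConcat.split hc h1
  obtain ⟨w', k3, k4⟩ := IsConcat.split he h2
  obtain rfl := k1.unique k3
  refine ⟨w, k2, k4, fun i => ?_⟩
  have h3 := congrFun hc.d_eq i
  have h4 := congrFun he.d_eq i
  have h5 := hm i
  simp only [Pi.add_apply] at h3 h4
  omega

theorem isComp_right (hg : Rel g a b) (hg' : Rel g c e) (hc : IsComp a α c) : IsComp b α e := by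
  obtain ⟨e', h1, h2⟩ := hg.extend hc hg'.pre_left
  rwa [(hg'.eq_of_d_eq h2 rfl).2]

theorem join (hg : Rel g a b) (hp : Pre a' g.1.1) :
    ∃ α α' c e, IsComp a α c ∧ IsComp a' α' c ∧ IsComp b α e ∧ Rel g c e := by
  obtain ⟨α, α', c, h1, h2, -, h4⟩ := hg.pre_left.join hp
  obtain ⟨e, h5, h6⟩ := hg.extend h1 h4
  exact ⟨α, α', c, e, h1, h2, h5, h6⟩

theorem inv (hg : Rel g a b) : Rel ((pathGroupoid Λ).inv g) b a := by
  obtain ⟨z, h1, h2, hm⟩ := hg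
  refine ⟨z, h2, h1, fun i => ?_⟩
  change _ = -(g.1.2.1 i)
  rw [← hm i]; ring

theorem comp (hg : Rel g a b) (hh : Rel h b c) (e : (pathGroupoid Λ).s g = (pathGroupoid Λ).r h) :
    Rel ((pathGroupoid Λ).comp g h e) a c := by
  obtain ⟨z, h1, h2, hm⟩ := hg
  obtain ⟨z', h1', h2', hm'⟩ := hh
  have e' : g.1.2.2 = h.1.1 := e
  rw [← e'] at h1'
  obtain rfl := (h2.eq_of_d_eq h1' rfl).2
  refine ⟨z, h1, h2', fun i => ?_⟩
  change _ = g.1.2.1 i + h.1.2.1 i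
  rw [← hm i, ← hm' i]; ring

end Rel

theorem rel_inv_iff {g : (pathGroupoid Λ).Mor} {a b : Λ.Mor} :
    Rel ((pathGroupoid Λ).inv g) b a ↔ Rel g a b := by
  refine ⟨fun h => ?_, Rel.inv⟩
  have := h.inv
  rwa [show (pathGroupoid Λ).inv ((pathGroupoid Λ).inv g) = g from
    Subtype.ext (Prod.ext rfl (Prod.ext (neg_neg _) rfl))] at this

theorem rel_one_iff {x : PathSpace Λ} {a b : Λ.Mor} :
    Rel ((pathGroupoid Λ).one x) a b ↔ a = b ∧ Pre a x := by
  constructor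
  · intro h
    have hd : Λ.d a = Λ.d b := funext fun i => by
      have h1 : (Λ.d a i : ℤ) - (Λ.d b i : ℤ) = 0 := h.sub_eq i
      omega
    exact ⟨h.pre_left.eq_of_d_eq h.pre_right hd, h.pre_left⟩
  · rintro ⟨rfl, z, h⟩
    exact ⟨z, h, h, fun i => sub_self _⟩

/-- The middle components of a pair for g and a pair for h begin the same path, so both pairs can be
extended to a common middle component. -/
theorem exists_rel_rel {g h : (pathGroupoid Λ).Mor}
    (e : (pathGroupoid Λ).s g = (pathGroupoid Λ).r h) : ∃ a b c, Rel g a b ∧ Rel h b c := by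
  have e' : g.1.2.2 = h.1.1 := e
  obtain ⟨a₁, b₁, h₁⟩ := exists_rel g
  obtain ⟨b₂, c₂, h₂⟩ := exists_rel h
  obtain ⟨α, α', b, a, k1, k2, k3, k4⟩ := h₁.inv.join (a' := b₂) (by
    change Pre b₂ g.1.2.2; rw [e']; exact h₂.pre_left)
  obtain ⟨c, -, k6⟩ := h₂.extend k2 (e' ▸ k4.pre_left)
  exact ⟨a, b, c, rel_inv_iff.1 k4, k6⟩

theorem pre_of_rel_imp {g g' : (pathGroupoid Λ).Mor} (h : ∀ a b, Rel g a b → Rel g' a b)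
    {a : Λ.Mor} (ha : Pre a g.1.1) : Pre a g'.1.1 := by
  obtain ⟨a₀, b₀, h₀⟩ := exists_rel g
  obtain ⟨α, α', c, e, -, h2, -, h4⟩ := h₀.join ha
  exact (h _ _ h4).pre_left.of_comp h2

/-- Every initial segment of the range path extends to the left component of a related pair, so the
related pairs determine the range; inversion gives the source. -/
theorem ext_rel {g g' : (pathGroupoid Λ).Mor} (hm : g.1.2.1 = g'.1.2.1)
    (h : ∀ a b, Rel g a b ↔ Rel g' a b) : g = g' := by
  have h1 : g.1.1 = g'.1.1 := ext_pre fun a =>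
    ⟨pre_of_rel_imp fun _ _ => (h _ _).1, pre_of_rel_imp fun _ _ => (h _ _).2⟩
  have h2 : g.1.2.2 = g'.1.2.2 := ext_pre fun a =>
    ⟨pre_of_rel_imp (g := (pathGroupoid Λ).inv g) (g' := (pathGroupoid Λ).inv g')
        fun _ _ hh => rel_inv_iff.2 ((h _ _).1 (rel_inv_iff.1 hh)),
      pre_of_rel_imp (g := (pathGroupoid Λ).inv g') (g' := (pathGroupoid Λ).inv g)
        fun _ _ hh => rel_inv_iff.2 ((h _ _).2 (rel_inv_iff.1 hh))⟩
  exact Subtype.ext (Prod.ext h1 (Prod.ext hm h2))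

/-! ### Limits in `Λ` -/

theorem TopKGraph.isOpen_ofDegree (Λ : TopKGraph.{u, v} k) (m : Fin k → ℕ) :
    IsOpen (Λ.ofDegree m) := (isOpen_discrete {m}).preimage Λ.continuous_d

theorem TopKGraph.isClosed_ofDegree (Λ : TopKGraph.{u, v} k) (m : Fin k → ℕ) :
    IsClosed (Λ.ofDegree m) := (isClosed_discrete {m}).preimage Λ.continuous_d

theorem TopKGraph.ofDegree_mem_nhds (a : Λ.Mor) : Λ.ofDegree (Λ.d a) ∈ 𝓝 a :=
  (Λ.isOpen_ofDegree _).mem_nhds rfl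

theorem TopKGraph.eventually_d_eq {a : Λ.Mor} {a' : ι → Λ.Mor} (h : Tendsto a' l (𝓝 a)) :
    ∀ᶠ i in l, Λ.d (a' i) = Λ.d a := h.eventually (ofDegree_mem_nhds a)

theorem TopKGraph.exists_compact_nhds_ofDegree (a : Λ.Mor) :
    ∃ K ∈ 𝓝 a, IsCompact K ∧ K ⊆ Λ.ofDegree (Λ.d a) := by
  obtain ⟨K, hK, hKa⟩ := exists_compact_mem_nhds a
  exact ⟨K ∩ Λ.ofDegree (Λ.d a), inter_mem hKa (ofDegree_mem_nhds a),
    hK.inter_right (Λ.isClosed_ofDegree _), Set.inter_subset_right⟩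

/-- This is openness of composition, in neighbourhood form. -/
theorem TopKGraph.IsComp.eventually_exists {a b c : Λ.Mor} (h : IsComp a b c) {U V : Set Λ.Mor}
    (hU : U ∈ 𝓝 a) (hV : V ∈ 𝓝 b) : ∀ᶠ c' in 𝓝 c, ∃ a' ∈ U, ∃ b' ∈ V, IsComp a' b' c' := by
  obtain ⟨h, rfl⟩ := h
  have hcont : Continuous fun p : Λ.Composable => (p.1 : Λ.Mor × Λ.Mor) := continuous_subtype_val
  have h1 := Λ.isOpenMap_comp.nhds_le ⟨(a, b), h⟩
  have h2 : {p : Λ.Composable | p.1.1 ∈ U ∧ p.1.2 ∈ V} ∈ 𝓝 (⟨(a, b), h⟩ : Λ.Composable) :=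
    hcont.continuousAt (prod_mem_nhds hU hV)
  filter_upwards [h1 (image_mem_map h2)]
  rintro _ ⟨p, ⟨hp1, hp2⟩, rfl⟩
  exact ⟨_, hp1, _, hp2, p.2, rfl⟩

/-- The factorization of paths is continuous. -/
theorem TopKGraph.IsComp.tendsto_factor {a b c : Λ.Mor} (h : IsComp a b c) {c' : ι → Λ.Mor}
    (hc : Tendsto c' l (𝓝 c)) : ∃ a' b' : ι → Λ.Mor, Tendsto a' l (𝓝 a) ∧ Tendsto b' l (𝓝 b) ∧
      ∀ᶠ i in l, IsComp (a' i) (b' i) (c' i) := by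
  -- The candidate is the factorization with first factor of degree d(a). The default (a, b) occurs
  -- only where c' i has too small a degree, which eventually does not happen since d is locally
  -- constant.
  have h1 : ∀ i, ∃ p : Λ.Mor × Λ.Mor, Λ.d a ≤ Λ.d (c' i) →
      IsComp p.1 p.2 (c' i) ∧ Λ.d p.1 = Λ.d a := fun i => by
    by_cases hi : Λ.d a ≤ Λ.d (c' i)
    · obtain ⟨x, y, hx, hy⟩ := exists_isComp_of_le hi
      exact ⟨(x, y), fun _ => ⟨hx, hy⟩⟩
    · exact ⟨(a, b), fun hh => absurd hh hi⟩
  choose p hp using h1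
  have h2 : ∀ᶠ i in l, IsComp (p i).1 (p i).2 (c' i) ∧ Λ.d (p i).1 = Λ.d a := by
    filter_upwards [eventually_d_eq hc] with i hi
    exact hp i (hi ▸ h.le_d)
  have h3 : ∀ U ∈ 𝓝 a, ∀ V ∈ 𝓝 b, ∀ᶠ i in l, (p i).1 ∈ U ∧ (p i).2 ∈ V := by
    intro U hU V hV
    filter_upwards [h2, hc.eventually
      (h.eventually_exists (inter_mem hU (ofDegree_mem_nhds a)) hV)] with i hi hi'
    obtain ⟨x, ⟨hx, hxd⟩, y, hy, hxy⟩ := hi'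
    obtain ⟨e1, e2⟩ := hi.1.factor_unique hxy (hi.2.trans hxd.symm)
    exact ⟨e1 ▸ hx, e2 ▸ hy⟩
  refine ⟨fun i => (p i).1, fun i => (p i).2, fun U hU => ?_, fun V hV => ?_,
    h2.mono fun i hi => hi.1⟩
  · exact (h3 U hU Set.univ univ_mem).mono fun i hi => hi.1
  · exact (h3 Set.univ univ_mem V hV).mono fun i hi => hi.2

/-- The limits are again composable because the object space is Hausdorff; then composition is
continuous. -/
theorem TopKGraph.tendsto_comp [l.NeBot] {a b : Λ.Mor} {a' b' c' : ι → Λ.Mor}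
    (ha : Tendsto a' l (𝓝 a)) (hb : Tendsto b' l (𝓝 b))
    (hc : ∀ᶠ i in l, IsComp (a' i) (b' i) (c' i)) :
    ∃ c, IsComp a b c ∧ Tendsto c' l (𝓝 c) := by
  have h : Λ.s a = Λ.r b := tendsto_nhds_unique_of_eventuallyEq
    ((Λ.continuous_s.tendsto a).comp ha) ((Λ.continuous_r.tendsto b).comp hb)
    (hc.mono fun i hi => hi.1)
  refine ⟨_, ⟨h, rfl⟩, fun W hW => ?_⟩
  have h1 := Λ.continuous_comp.tendsto ⟨(a, b), h⟩ hW
  obtain ⟨S, hS, hSW⟩ := (mem_nhds_subtype {p : Λ.Mor × Λ.Mor | Λ.s p.1 = Λ.r p.2}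
    ⟨(a, b), h⟩ _).1 h1
  rw [mem_map]
  filter_upwards [hc, (ha.prodMk_nhds hb).eventually hS] with i hi hi'
  obtain ⟨hi, e⟩ := hi
  rw [Set.mem_preimage, ← e]
  exact hSW (show (⟨(a' i, b' i), hi⟩ : {p : Λ.Mor × Λ.Mor | Λ.s p.1 = Λ.r p.2}) ∈ _ from hi')

theorem TopKGraph.exists_isOpen_injOn_s (a : Λ.Mor) :
    ∃ U : Set Λ.Mor, IsOpen U ∧ a ∈ U ∧ Set.InjOn Λ.s U := by
  obtain ⟨e, ha, he⟩ := Λ.isLocalHomeomorph_s a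
  exact ⟨e.source, e.open_source, ha, he ▸ e.injOn⟩

theorem TopKGraph.eventually_eq_of_s_eq {a : Λ.Mor} {a' b' : ι → Λ.Mor}
    (ha : Tendsto a' l (𝓝 a)) (hb : Tendsto b' l (𝓝 a))
    (h : ∀ᶠ i in l, Λ.s (a' i) = Λ.s (b' i)) : ∀ᶠ i in l, a' i = b' i := by
  obtain ⟨U, hU, haU, hinj⟩ := exists_isOpen_injOn_s a
  filter_upwards [h, ha (hU.mem_nhds haU), hb (hU.mem_nhds haU)] with i hi h1 h2
  exact hinj h1 h2 hi

theorem TopKGraph.exists_tendsto_lift_s {a : Λ.Mor} {t : ι → Λ.Obj}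
    (h : Tendsto t l (𝓝 (Λ.s a))) :
    ∃ a' : ι → Λ.Mor, Tendsto a' l (𝓝 a) ∧ ∀ᶠ i in l, Λ.s (a' i) = t i := by
  obtain ⟨e, ha, he⟩ := Λ.isLocalHomeomorph_s a
  rw [he] at h ⊢
  have ht := e.map_source ha
  refine ⟨fun i => e.symm (t i), ?_, ?_⟩
  · have := (e.continuousAt_symm ht).tendsto.comp h
    rwa [e.left_inv ha] at this
  · filter_upwards [h (e.open_target.mem_nhds ht)] with i hi
    exact e.right_inv hi

/-! ### Neighbourhoods in the path groupoid -/

theorem isOpen_cylinder {U V : Set Λ.Mor} (hU : IsOpen U) (hV : IsOpen V) (m : Fin k → ℤ) :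
    IsOpen (cylinder Λ (starS Λ U V) m) := by
  refine TopologicalSpace.isOpen_generateFrom_of_mem
    ⟨m, U, V, ∅, hU, hV, Set.empty_subset _, isCompact_empty, ?_⟩
  rw [eq_comm, Set.inter_eq_left]
  rintro g - ⟨p, hp, -⟩
  exact hp

theorem mem_cylinder_starS_iff {U V : Set Λ.Mor} {m : Fin k → ℤ} {g : (pathGroupoid Λ).Mor} :
    g ∈ cylinder Λ (starS Λ U V) m ↔ g.1.2.1 = m ∧ ∃ a ∈ U, ∃ b ∈ V, Rel g a b := by
  rw [mem_cylinder_iff]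
  refine and_congr_right fun _ => ⟨?_, ?_⟩
  · rintro ⟨p, ⟨h1, h2, -⟩, h⟩
    exact ⟨_, h1, _, h2, h⟩
  · rintro ⟨a, h1, b, h2, h⟩
    exact ⟨(a, b), ⟨h1, h2, h.s_eq⟩, h⟩

theorem mem_cylinder_univ (g : (pathGroupoid Λ).Mor) :
    g ∈ cylinder Λ (starS Λ Set.univ Set.univ) g.1.2.1 := by
  obtain ⟨a, b, h⟩ := exists_rel g
  exact mem_cylinder_starS_iff.2 ⟨rfl, a, trivial, b, trivial, h⟩

theorem Rel.eventually_exists {g : (pathGroupoid Λ).Mor} {a b : Λ.Mor} (h : Rel g a b)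
    {U V : Set Λ.Mor} (hU : U ∈ 𝓝 a) (hV : V ∈ 𝓝 b) :
    ∀ᶠ g' in 𝓝 g, g'.1.2.1 = g.1.2.1 ∧ ∃ a' ∈ U, ∃ b' ∈ V, Rel g' a' b' := by
  obtain ⟨U', hU', hUo, haU⟩ := mem_nhds_iff.1 hU
  obtain ⟨V', hV', hVo, hbV⟩ := mem_nhds_iff.1 hV
  filter_upwards [(isOpen_cylinder hUo hVo g.1.2.1).mem_nhds
    (mem_cylinder_starS_iff.2 ⟨rfl, a, haU, b, hbV, h⟩)] with g' hg'
  obtain ⟨hm, a', ha', b', hb', h'⟩ := mem_cylinder_starS_iff.1 hg'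
  exact ⟨hm, a', hU' ha', b', hV' hb', h'⟩

theorem eventually_cocycle_eq (g : (pathGroupoid Λ).Mor) :
    ∀ᶠ g' in 𝓝 g, g'.1.2.1 = g.1.2.1 := by
  obtain ⟨a, b, h⟩ := exists_rel g
  exact (h.eventually_exists univ_mem univ_mem).mono fun g' hg' => hg'.1

theorem eventually_notMem_cylinder {g : (pathGroupoid Λ).Mor} {F : Set (Λ.Mor × Λ.Mor)}
    (hF : F ⊆ starS Λ Set.univ Set.univ) (hFc : IsCompact F)
    (h : g ∉ cylinder Λ F g.1.2.1) : ∀ᶠ g' in 𝓝 g, g' ∉ cylinder Λ F g.1.2.1 :=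
  mem_of_superset ((TopologicalSpace.isOpen_generateFrom_of_mem
    ⟨g.1.2.1, Set.univ, Set.univ, F, isOpen_univ, isOpen_univ, hF, hFc, rfl⟩ :
      IsOpen (cylinder Λ (starS Λ Set.univ Set.univ) g.1.2.1 ∩ (cylinder Λ F g.1.2.1)ᶜ)).mem_nhds
        ⟨mem_cylinder_univ g, h⟩) Set.inter_subset_right

theorem isClosed_starS_univ : IsClosed (starS Λ Set.univ Set.univ) := by
  have : starS Λ Set.univ Set.univ = {p : Λ.Mor × Λ.Mor | Λ.s p.1 = Λ.s p.2} := by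
    ext p; simp [starS]
  rw [this]
  exact isClosed_eq (Λ.continuous_s.comp continuous_fst) (Λ.continuous_s.comp continuous_snd)

/-- On the open set where the first component has a prescribed degree there is at most one related
pair. -/
theorem isClosed_rel (g : (pathGroupoid Λ).Mor) :
    IsClosed {p : Λ.Mor × Λ.Mor | Rel g p.1 p.2} := by
  refine isClosed_of_closure_subset fun p hp => ?_
  have hU : {q : Λ.Mor × Λ.Mor | Λ.d q.1 = Λ.d p.1} ∈ 𝓝 p :=
    continuous_fst.continuousAt (ofDegree_mem_nhds p.1)
  obtain ⟨q, hqd, hq⟩ := mem_closure_iff_nhds.1 hp _ hU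
  by_contra hcon
  have hne : p ≠ q := fun e => hcon (e ▸ hq)
  obtain ⟨q', ⟨hqd', hne'⟩, hq'⟩ := mem_closure_iff_nhds.1 hp _
    (inter_mem hU (isOpen_ne.mem_nhds hne))
  obtain ⟨e1, e2⟩ := Rel.eq_of_d_eq hq' hq (Eq.trans hqd' (Eq.symm hqd))
  exact hne' (Prod.ext e1 e2)

/-! ### Convergence in the path groupoid -/

/-- `(a, b)` is a limit of pairs `(aᵢ, bᵢ)` with `Rel (gᵢ) aᵢ bᵢ`. -/
def LimRel (l : Filter ι) (g : ι → (pathGroupoid Λ).Mor) (a b : Λ.Mor) : Prop :=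
  ∃ a' b' : ι → Λ.Mor, Tendsto a' l (𝓝 a) ∧ Tendsto b' l (𝓝 b) ∧ ∀ᶠ i in l, Rel (g i) (a' i) (b' i)

/-- `a` is a limit of initial segments of the paths `xᵢ`. -/
def LimPre (l : Filter ι) (x : ι → PathSpace Λ) (a : Λ.Mor) : Prop :=
  ∃ a' : ι → Λ.Mor, Tendsto a' l (𝓝 a) ∧ ∀ᶠ i in l, Pre (a' i) (x i)

/-- Each neighbourhood of (a, b) eventually contains related pairs of g i. Those with left degree
d(a) are unique, so a single choice serves all neighbourhoods at once. -/
theorem Rel.limRel {g : ι → (pathGroupoid Λ).Mor} {g₀ : (pathGroupoid Λ).Mor} {a b : Λ.Mor}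
    (h : Rel g₀ a b) (hg : Tendsto g l (𝓝 g₀)) : LimRel l g a b := by
  have h1 : ∀ i, ∃ p : Λ.Mor × Λ.Mor, (∃ a' b', Rel (g i) a' b' ∧ Λ.d a' = Λ.d a) →
      Rel (g i) p.1 p.2 ∧ Λ.d p.1 = Λ.d a := fun i => by
    by_cases hi : ∃ a' b', Rel (g i) a' b' ∧ Λ.d a' = Λ.d a
    · obtain ⟨a', b', hi⟩ := hi
      exact ⟨(a', b'), fun _ => hi⟩
    · exact ⟨(a, b), fun hh => absurd hh hi⟩
  choose p hp using h1
  have h3 : ∀ U ∈ 𝓝 a, ∀ V ∈ 𝓝 b, ∀ᶠ i in l,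
      Rel (g i) (p i).1 (p i).2 ∧ (p i).1 ∈ U ∧ (p i).2 ∈ V := by
    intro U hU V hV
    filter_upwards [hg.eventually
      (h.eventually_exists (inter_mem hU (ofDegree_mem_nhds a)) hV)] with i hi
    obtain ⟨-, x, ⟨hx, hxd⟩, y, hy, hxy⟩ := hi
    obtain ⟨k1, k2⟩ := hp i ⟨x, y, hxy, hxd⟩
    obtain ⟨e1, e2⟩ := k1.eq_of_d_eq hxy (k2.trans hxd.symm)
    exact ⟨k1, e1 ▸ hx, e2 ▸ hy⟩
  refine ⟨fun i => (p i).1, fun i => (p i).2, fun U hU => ?_, fun V hV => ?_, ?_⟩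
  · exact (h3 U hU Set.univ univ_mem).mono fun i hi => hi.2.1
  · exact (h3 Set.univ univ_mem V hV).mono fun i hi => hi.2.2
  · exact (h3 _ univ_mem _ univ_mem).mono fun i hi => hi.1

namespace LimRel

variable {g : ι → (pathGroupoid Λ).Mor} {g₀ : (pathGroupoid Λ).Mor} {a b c e e' α a' b' : Λ.Mor}

theorem s_eq [l.NeBot] (h : LimRel l g a b) : Λ.s a = Λ.s b := by
  obtain ⟨a', b', h1, h2, h3⟩ := h
  exact tendsto_nhds_unique_of_eventuallyEq ((Λ.continuous_s.tendsto a).comp h1)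
    ((Λ.continuous_s.tendsto b).comp h2) (h3.mono fun i hi => hi.s_eq)

theorem limPre (h : LimRel l g a b) : LimPre l (fun i => (g i).1.1) a := by
  obtain ⟨a', b', h1, -, h3⟩ := h
  exact ⟨a', h1, h3.mono fun i hi => hi.pre_left⟩

/-- Otherwise some compact neighbourhood K of (a, b) contains no related pair of g₀. Then avoiding
the cylinder over K is an open condition satisfied by g₀, which the g i violate. -/
theorem rel [l.NeBot] (h : LimRel l g a b) (hg : Tendsto g l (𝓝 g₀)) : Rel g₀ a b := by
  have hs := h.s_eq
  obtain ⟨a', b', h1, h2, h3⟩ := h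
  by_contra hcon
  obtain ⟨K, hK, hKs, hKc⟩ := local_compact_nhds
    ((isClosed_rel g₀).isOpen_compl.mem_nhds (x := (a, b)) hcon)
  have hF := eventually_notMem_cylinder (g := g₀) (F := K ∩ starS Λ Set.univ Set.univ)
    Set.inter_subset_right (hKc.inter_right isClosed_starS_univ) (by
      rw [mem_cylinder_iff]
      rintro ⟨-, p, hp, hp'⟩
      exact hKs hp.1 hp')
  obtain ⟨i, h4, h5, h6, h7⟩ := ((hg.eventually hF).and ((hg.eventually
    (eventually_cocycle_eq g₀)).and (h3.and ((h1.prodMk_nhds h2) hK)))).exists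
  exact h4 (mem_cylinder_iff.2 ⟨h5, _, ⟨h7, trivial, trivial, h6.s_eq⟩, h6⟩)

/-- Factoring the approximating pairs gives two families of tails, both converging to α and with
equal sources; local injectivity of s makes them eventually equal, so they can be moved into the
remainder path. -/
theorem restrict (h : LimRel l g c e) (hc : IsComp a α c) (he : IsComp b α e) :
    LimRel l g a b := by
  obtain ⟨c', e', h1, h2, h3⟩ := h
  obtain ⟨a', α', k1, k2, k3⟩ := hc.tendsto_factor h1
  obtain ⟨b', β', k4, k5, k6⟩ := he.tendsto_factor h2
  refine ⟨a', b', k1, k4, ?_⟩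
  have : ∀ᶠ i in l, α' i = β' i := eventually_eq_of_s_eq k2 k5 (by
    filter_upwards [h3, k3, k6] with i h3 k3 k6
    rw [← k3.s_eq, ← k6.s_eq, h3.s_eq])
  filter_upwards [h3, k3, k6, this] with i h3 k3 k6 hi
  exact h3.restrict k3 (hi ▸ k6)

theorem extend [l.NeBot] (h : LimRel l g a b) (hc : IsComp a α c)
    (hp : LimPre l (fun i => (g i).1.1) c) : ∃ e, IsComp b α e ∧ LimRel l g c e := by
  obtain ⟨a', b', h1, h2, h3⟩ := h
  obtain ⟨c', h4, h5⟩ := hp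
  obtain ⟨a'', α', k1, k2, k3⟩ := hc.tendsto_factor h4
  have h6 : ∀ᶠ i in l, ∃ e, IsComp (b' i) (α' i) e ∧ Rel (g i) (c' i) e := by
    filter_upwards [h3, h5, k3, eventually_d_eq h1, eventually_d_eq k1] with i h3 h5 k3 e1 e2
    -- The first factor of c' i and a' i begin the same path and have the same degree, so they
    -- coincide.
    rw [(h5.of_comp k3).eq_of_d_eq h3.pre_left (e2.trans e1.symm)] at k3
    exact h3.extend k3 h5
  have : Nonempty Λ.Mor := ⟨a⟩
  obtain ⟨e', he'⟩ := h6.choice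
  obtain ⟨e, k4, k5⟩ := tendsto_comp h2 k2 (he'.mono fun i hi => hi.1)
  exact ⟨e, k4, c', e', h4, k5, he'.mono fun i hi => hi.2⟩

theorem unique [l.NeBot] (h : LimRel l g c e) (h' : LimRel l g c e') : e = e' := by
  obtain ⟨c₁, e₁, h1, h2, h3⟩ := h
  obtain ⟨c₂, e₂, k1, k2, k3⟩ := h'
  refine tendsto_nhds_unique_of_eventuallyEq h2 k2 ?_
  filter_upwards [h3, k3, eventually_d_eq h1, eventually_d_eq k1] with i h3 k3 d1 d2
  exact (h3.eq_of_d_eq k3 (d1.trans d2.symm)).2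

theorem isComp_right [l.NeBot] (h : LimRel l g a b) (h' : LimRel l g c e) (hc : IsComp a α c) :
    IsComp b α e := by
  obtain ⟨e', h1, h2⟩ := h.extend hc h'.limPre
  rwa [h'.unique h2]

end LimRel

theorem LimPre.of_comp {x : ι → PathSpace Λ} {a α c : Λ.Mor} (h : LimPre l x c)
    (hc : IsComp a α c) : LimPre l x a := by
  obtain ⟨c', h1, h2⟩ := h
  obtain ⟨a', α', k1, k2, k3⟩ := hc.tendsto_factor h1
  refine ⟨a', k1, ?_⟩
  filter_upwards [h2, k3] with i h2 k3
  exact h2.of_comp k3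

/-! ### Limits along ultrafilters: compact alignment, compact cylinders and separation -/

theorem exists_tendsto_of_mem_compact {X : Type*} [TopologicalSpace X] {𝒰 : Ultrafilter ι}
    {K : Set X} (hK : IsCompact K) {f : ι → X} (hf : ∀ᶠ i in (𝒰 : Filter ι), f i ∈ K) :
    ∃ x ∈ K, Tendsto f 𝒰 (𝓝 x) :=
  hK.ultrafilter_le_nhds (𝒰.map f) (le_principal_iff.2 hf)

/-- Compact alignment enters here. The minimal common extensions along x i of the segments near a
and b lie in K ∨ K' for compact K, K', hence converge along the ultrafilter. -/
theorem LimPre.join (hΛ : Λ.CompactlyAligned) {𝒰 : Ultrafilter ι} {x : ι → PathSpace Λ}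
    {a b : Λ.Mor} (ha : LimPre 𝒰 x a) (hb : LimPre 𝒰 x b) :
    ∃ α β c, IsComp a α c ∧ IsComp b β c ∧ Λ.d c = Λ.d a ⊔ Λ.d b ∧ LimPre 𝒰 x c := by
  obtain ⟨a', h1, h2⟩ := ha
  obtain ⟨b', k1, k2⟩ := hb
  obtain ⟨K, hKa, hK, hKd⟩ := exists_compact_nhds_ofDegree a
  obtain ⟨K', hKb, hK', hKd'⟩ := exists_compact_nhds_ofDegree b
  have h3 : ∀ᶠ i in (𝒰 : Filter ι), ∃ c, Pre c (x i) ∧ (∃ α, IsComp (a' i) α c) ∧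
      (∃ β, IsComp (b' i) β c) ∧ c ∈ Λ.minExt (Λ.d a) (Λ.d b) K K' := by
    filter_upwards [h2, k2, h1 hKa, k1 hKb] with i h2 k2 h3 k3
    obtain ⟨α, β, c, p1, p2, p3, p4⟩ := h2.join k2
    have d1 : Λ.d (a' i) = Λ.d a := hKd h3
    have d2 : Λ.d (b' i) = Λ.d b := hKd' k3
    refine ⟨c, p4, ⟨α, p1⟩, ⟨β, p2⟩, ⟨a' i, h3, α, ?_, p1⟩, ⟨b' i, k3, β, ?_, p2⟩⟩
    · change Λ.d α = _
      rw [← d1, ← d2, ← p3, p1.d_eq, add_tsub_cancel_left]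
    · change Λ.d β = _
      rw [← d1, ← d2, ← p3, p2.d_eq, add_tsub_cancel_left]
  have : Nonempty Λ.Mor := ⟨a⟩
  obtain ⟨c', hc'⟩ := h3.choice
  obtain ⟨c, ⟨⟨ξ, hξ, α, hα, hcξ⟩, ⟨η, hη, β, hβ, hcη⟩⟩, hc⟩ := exists_tendsto_of_mem_compact
    (hΛ _ _ K K' hKd hKd' hK hK') (hc'.mono fun i hi => hi.2.2.2)
  -- Membership in K ∨ K' only says that c extends some ξ in K and η in K'. Continuity of
  -- factorization shows that these are the limits a and b themselves.
  have key : ∀ {a ξ α : Λ.Mor} {a' : ι → Λ.Mor}, Tendsto a' 𝒰 (𝓝 a) → Λ.d ξ = Λ.d a →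
      IsComp ξ α c → (∀ᶠ i in (𝒰 : Filter ι), ∃ α, IsComp (a' i) α (c' i)) → ξ = a := by
    intro a ξ α a' ha hd hξ hi
    obtain ⟨ξ', α', q1, -, q3⟩ := hξ.tendsto_factor hc
    refine tendsto_nhds_unique_of_eventuallyEq q1 ha ?_
    filter_upwards [hi, q3, eventually_d_eq ha, eventually_d_eq q1] with i ⟨α, hi⟩ q3 d1 d2
    exact (q3.factor_unique hi (d2.trans (hd.trans d1.symm))).1
  obtain rfl := key h1 (hKd hξ) hcξ (hc'.mono fun i hi => hi.2.1)
  obtain rfl := key k1 (hKd' hη) hcη (hc'.mono fun i hi => hi.2.2.1)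
  refine ⟨α, β, c, hcξ, hcη, ?_, c', hc, hc'.mono fun i hi => hi.1⟩
  rw [IsComp.d_eq hcξ, show Λ.d α = _ from hα]
  exact add_tsub_cancel_of_le le_sup_left

/-- A criterion for convergence along ultrafilters. -/
theorem tendsto_of_limRel_iff {𝒰 : Ultrafilter ι} {g : ι → (pathGroupoid Λ).Mor}
    {g₀ : (pathGroupoid Λ).Mor} (hm : ∀ᶠ i in (𝒰 : Filter ι), (g i).1.2.1 = g₀.1.2.1)
    (h : ∀ a b, Rel g₀ a b ↔ LimRel 𝒰 g a b) : Tendsto g 𝒰 (𝓝 g₀) := by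
  rw [TopologicalSpace.tendsto_nhds_generateFrom_iff]
  rintro _ ⟨m, U, V, F, hU, hV, hF, hFc, rfl⟩ ⟨h1, h2⟩
  obtain ⟨rfl, a, haU, b, hbV, hab⟩ := mem_cylinder_starS_iff.1 h1
  rw [Set.preimage_inter]
  refine inter_mem ?_ ?_
  · obtain ⟨a', b', k1, k2, k3⟩ := (h a b).1 hab
    filter_upwards [hm, k1 (hU.mem_nhds haU), k2 (hV.mem_nhds hbV), k3] with i hm k1 k2 k3
    exact mem_cylinder_starS_iff.2 ⟨hm, _, k1, _, k2, k3⟩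
  -- If the ultrafilter avoids the complement, it contains Z(F, m). Related pairs chosen in F then
  -- converge in F, and their limit is a related pair of g₀ in F.
  · by_contra hcon
    have h3 : ∀ᶠ i in (𝒰 : Filter ι), ∃ p ∈ F, Rel (g i) p.1 p.2 := by
      have := Ultrafilter.compl_mem_iff_notMem.2 hcon
      filter_upwards [this] with i hi
      exact (mem_cylinder_iff.1 (not_not.1 hi)).2
    have : Nonempty (Λ.Mor × Λ.Mor) := ⟨(a, b)⟩
    obtain ⟨p, hp⟩ := h3.choice
    obtain ⟨q, hq, hpq⟩ := exists_tendsto_of_mem_compact hFc (hp.mono fun i hi => hi.1)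
    refine h2 (mem_cylinder_iff.2 ⟨rfl, q, hq, (h _ _).2 ⟨fun i => (p i).1, fun i => (p i).2,
      (continuous_fst.tendsto q).comp hpq, (continuous_snd.tendsto q).comp hpq,
      hp.mono fun i hi => hi.2⟩⟩)

theorem TopKGraph.IsComp.assoc_left {a α β γ c : Λ.Mor} (h : IsComp a γ c) (hγ : IsComp α β γ) :
    ∃ c', IsComp a α c' ∧ IsComp c' β c := by
  obtain ⟨h, rfl⟩ := h
  obtain ⟨hγ, rfl⟩ := hγ
  exact ⟨_, ⟨h.trans (Λ.r_comp _ _ _), rfl⟩, (Λ.s_comp _ _ _).trans hγ, Λ.assoc _ _ _ _ _⟩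

theorem TopKGraph.IsComp.assoc_right {a α β c c' : Λ.Mor} (h : IsComp a α c') (h' : IsComp c' β c) :
    ∃ γ, IsComp α β γ ∧ IsComp a γ c := by
  obtain ⟨h, rfl⟩ := h
  obtain ⟨h', rfl⟩ := h'
  exact ⟨_, ⟨(Λ.s_comp _ _ _).symm.trans h', rfl⟩, h.trans (Λ.r_comp _ _ _).symm,
    (Λ.assoc _ _ _ _ _).symm⟩

/-- If `(a, b)` is a limit of pairs related by `gᵢ`, then the limits of the segments of `gᵢ` past
`(a, b)` are the initial segments of a path. -/
theorem isPathFilter_limRel (hΛ : Λ.CompactlyAligned) {𝒰 : Ultrafilter ι}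
    {g : ι → (pathGroupoid Λ).Mor} {a b : Λ.Mor} (h : LimRel 𝒰 g a b) :
    IsPathFilter {α : Λ.Mor | ∃ c e, IsComp a α c ∧ IsComp b α e ∧ LimRel 𝒰 g c e} where
  nonempty := ⟨Λ.one (Λ.s a), a, b, isComp_one a, h.s_eq ▸ isComp_one b, h⟩
  of_comp := by
    rintro α β γ hγ ⟨c, e, h1, h2, h3⟩
    obtain ⟨c', k1, k2⟩ := h1.assoc_left hγ
    obtain ⟨e', k3, k4⟩ := h2.assoc_left hγ
    exact ⟨c', e', k1, k3, h3.restrict k2 k4⟩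
  join := by
    rintro α α' ⟨c, e, h1, h2, h3⟩ ⟨c', e', h1', h2', h3'⟩
    -- The join is formed for aα and aα', which are limits of initial segments of the ranges; the
    -- common factor a is cancelled afterwards by unique factorization.
    obtain ⟨β, β', c'', k1, k2, k3, k4⟩ := h3.limPre.join hΛ h3'.limPre
    obtain ⟨e'', k5, k6⟩ := h3.extend k1 k4
    obtain ⟨γ, p1, p2⟩ := h1.assoc_right k1
    obtain ⟨γ', p3, p4⟩ := h1'.assoc_right k2
    obtain ⟨γ₂, p5, p6⟩ := h2.assoc_right k5
    obtain rfl := (p4.factor_unique p2 rfl).2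
    obtain rfl := p5.unique p1
    refine ⟨γ₂, ⟨c'', e'', p2, p6, k6⟩, ?_, ⟨β, p1⟩, ⟨β', p3⟩⟩
    funext i
    have q1 := congrFun p2.d_eq i
    have q2 := congrFun h1.d_eq i
    have q3 := congrFun h1'.d_eq i
    have q4 := congrFun k3 i
    simp only [Pi.add_apply, Pi.sup_apply] at q1 q2 q3 q4 ⊢
    omega

/-- With z the path of the filter above, the limit is (az, m, bz). To compare its related pairs with
the limit pairs, any pair (c, e) is extended to one lying past (a, b), where the filter decides, and
then restricted back. -/
theorem exists_tendsto_of_limRel (hΛ : Λ.CompactlyAligned) {𝒰 : Ultrafilter ι}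
    {g : ι → (pathGroupoid Λ).Mor} {a b : Λ.Mor} {m : Fin k → ℤ}
    (hm : ∀ᶠ i in (𝒰 : Filter ι), (g i).1.2.1 = m) (h : LimRel 𝒰 g a b) :
    ∃ g₀ : (pathGroupoid Λ).Mor, g₀.1.2.1 = m ∧ Tendsto g 𝒰 (𝓝 g₀) := by
  have hP := isPathFilter_limRel hΛ h
  have hz : Λ.s a = hP.path.r := by
    -- The identity at s(a) lies in the filter, so the path starts at s(a).
    obtain ⟨w, hw⟩ := (hP.pre_path_iff (Λ.one (Λ.s a))).2
      ⟨a, b, isComp_one a, h.s_eq ▸ isComp_one b, h⟩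
    rw [← hw.r_eq, Λ.r_one]
  obtain ⟨g₀, hx, hy, hg₀, hm₀⟩ := exists_rel_mk hz (h.s_eq.symm.trans hz)
  have hm₁ : g₀.1.2.1 = m := by
    obtain ⟨a', b', h1, h2, h3⟩ := h
    obtain ⟨i, hi, h3, d1, d2⟩ :=
      (hm.and (h3.and ((eventually_d_eq h1).and (eventually_d_eq h2)))).exists
    rw [hm₀, ← hi]
    funext j
    rw [← h3.sub_eq j, d1, d2]
  refine ⟨g₀, hm₁, tendsto_of_limRel_iff (hm.mono fun i hi => hi.trans hm₁.symm) fun c e =>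
    ⟨fun hce => ?_, fun hce => ?_⟩⟩
  · obtain ⟨α, α', c₁, e₁, h1, h2, h3, h4⟩ := hg₀.join hce.pre_left
    obtain ⟨w, hw⟩ := h4.pre_left
    obtain ⟨c₂, e₂, k1, k2, k3⟩ := (hP.pre_path_iff α).1 ⟨w, IsConcat.of_comp h1 hx hw⟩
    obtain rfl := k1.unique h1
    obtain rfl := k2.unique h3
    exact k3.restrict h2 (hce.isComp_right h4 h2)
  · obtain ⟨α, α', c₁, h1, h2, -, h4⟩ := h.limPre.join hΛ hce.limPre
    obtain ⟨e₁, h5, h6⟩ := h.extend h1 h4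
    obtain ⟨w, hw⟩ := (hP.pre_path_iff α).2 ⟨c₁, e₁, h1, h5, h6⟩
    obtain ⟨e₂, k1, k2⟩ := hg₀.extend h1 ⟨w, IsConcat.comp h1 hw hx⟩
    obtain rfl := k1.unique h5
    exact k2.restrict h2 (hce.isComp_right h6 h2)

theorem isCompact_cylinder (hΛ : Λ.CompactlyAligned) {F : Set (Λ.Mor × Λ.Mor)} (hF : IsCompact F)
    (m : Fin k → ℤ) : IsCompact (cylinder Λ F m) := by
  rw [isCompact_iff_ultrafilter_le_nhds]
  intro 𝒰 h𝒰
  have h1 : ∀ᶠ g in (𝒰 : Filter (pathGroupoid Λ).Mor),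
      g.1.2.1 = m ∧ ∃ p ∈ F, Rel g p.1 p.2 := by
    filter_upwards [le_principal_iff.1 h𝒰] with g hg
    exact mem_cylinder_iff.1 hg
  obtain ⟨g, -, p₀, -⟩ := h1.exists
  have : Nonempty (Λ.Mor × Λ.Mor) := ⟨p₀⟩
  obtain ⟨p, hp⟩ := (h1.mono fun g hg => hg.2).choice
  obtain ⟨q, hq, hpq⟩ := exists_tendsto_of_mem_compact hF (hp.mono fun i hi => hi.1)
  have hL : LimRel 𝒰 id q.1 q.2 := ⟨_, _, (continuous_fst.tendsto q).comp hpq,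
    (continuous_snd.tendsto q).comp hpq, hp.mono fun i hi => hi.2⟩
  obtain ⟨g₀, hm, hg₀⟩ := exists_tendsto_of_limRel hΛ (h1.mono fun g hg => hg.1) hL
  exact ⟨g₀, mem_cylinder_iff.2 ⟨hm, q, hq, hL.rel hg₀⟩, hg₀⟩

/-- The related pairs of any limit of an ultrafilter are exactly the limit pairs, which depend on
the ultrafilter alone. -/
theorem t2Space_pathGroupoid : T2Space (pathGroupoid Λ).Mor := by
  rw [t2_iff_ultrafilter]
  intro g g' 𝒰 h h'
  have h1 : Tendsto id (𝒰 : Filter (pathGroupoid Λ).Mor) (𝓝 g) := h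
  have h2 : Tendsto id (𝒰 : Filter (pathGroupoid Λ).Mor) (𝓝 g') := h'
  obtain ⟨i, hi, hi'⟩ := ((h1.eventually (eventually_cocycle_eq g)).and
    (h2.eventually (eventually_cocycle_eq g'))).exists
  exact ext_rel (hi.symm.trans hi') fun a b =>
    ⟨fun hh => (hh.limRel h1).rel h2, fun hh => (hh.limRel h2).rel h1⟩

theorem locallyCompactSpace_pathGroupoid (hΛ : Λ.CompactlyAligned) :
    LocallyCompactSpace (pathGroupoid Λ).Mor := by
  have := t2Space_pathGroupoid (Λ := Λ)
  have : WeaklyLocallyCompactSpace (pathGroupoid Λ).Mor := by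
    refine ⟨fun g => ?_⟩
    obtain ⟨a, b, h⟩ := exists_rel g
    obtain ⟨K, hK, hKa⟩ := exists_compact_mem_nhds a
    obtain ⟨K', hK', hKb⟩ := exists_compact_mem_nhds b
    refine ⟨cylinder Λ ((K ×ˢ K') ∩ starS Λ Set.univ Set.univ) g.1.2.1,
      isCompact_cylinder hΛ ((hK.prod hK').inter_right isClosed_starS_univ) _, ?_⟩
    filter_upwards [h.eventually_exists hKa hKb] with g' ⟨hm, a', ha', b', hb', h'⟩
    exact mem_cylinder_iff.2 ⟨hm, (a', b'), ⟨⟨ha', hb'⟩, trivial, trivial, h'.s_eq⟩, h'⟩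
  infer_instance

/-! ### The structure maps -/

theorem continuous_inv_pathGroupoid : Continuous (pathGroupoid Λ).inv := by
  rw [continuous_iff_ultrafilter]
  intro g 𝒰 h
  refine tendsto_of_limRel_iff (g₀ := (pathGroupoid Λ).inv g) ?_ fun a b => ?_
  · filter_upwards [h (eventually_cocycle_eq g)] with g' hg'
    exact congrArg Neg.neg hg'
  · have h' : Tendsto id (𝒰 : Filter (pathGroupoid Λ).Mor) (𝓝 g) := h
    constructor
    · intro hab
      obtain ⟨b', a', h1, h2, h3⟩ := (rel_inv_iff.1 hab).limRel h'
      exact ⟨a', b', h2, h1, h3.mono fun i hi => hi.inv⟩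
    · rintro ⟨a', b', h1, h2, h3⟩
      exact rel_inv_iff.2 (LimRel.rel ⟨b', a', h2, h1, h3.mono fun i hi => rel_inv_iff.1 hi⟩ h')

theorem limRel_one_iff {l : Filter ι} [l.NeBot] {x : ι → PathSpace Λ} {a b : Λ.Mor} :
    LimRel l (fun i => (pathGroupoid Λ).one (x i)) a b ↔ a = b ∧ LimPre l x a := by
  constructor
  · rintro ⟨a', b', h1, h2, h3⟩
    exact ⟨tendsto_nhds_unique_of_eventuallyEq h1 h2 (h3.mono fun i hi => (rel_one_iff.1 hi).1),
      a', h1, h3.mono fun i hi => hi.pre_left⟩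
  · rintro ⟨rfl, a', h1, h2⟩
    exact ⟨a', a', h1, h1, h2.mono fun i hi => rel_one_iff.2 ⟨rfl, hi⟩⟩

theorem limPre_iff_of_tendsto {l : Filter ι} [l.NeBot] {x : ι → (pathGroupoid Λ).Obj}
    {x₀ : (pathGroupoid Λ).Obj} (h : Tendsto x l (𝓝 x₀)) {a : Λ.Mor} :
    LimPre l x a ↔ Pre a x₀ := by
  have h' : Tendsto (fun i => (pathGroupoid Λ).one (x i)) l (𝓝 ((pathGroupoid Λ).one x₀)) :=
    (continuous_induced_dom.tendsto x₀).comp h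
  exact ⟨fun hh => (rel_one_iff.1 ((limRel_one_iff.2 ⟨rfl, hh⟩ : LimRel l _ a a).rel h')).2,
    fun hh => (limRel_one_iff.1 ((rel_one_iff.2 ⟨rfl, hh⟩ : Rel _ a a).limRel h')).2⟩

theorem tendsto_of_limPre_iff {𝒰 : Ultrafilter ι} {x : ι → (pathGroupoid Λ).Obj}
    {x₀ : (pathGroupoid Λ).Obj} (h : ∀ a, LimPre 𝒰 x a ↔ Pre a x₀) : Tendsto x 𝒰 (𝓝 x₀) := by
  rw [nhds_induced, tendsto_comap_iff]
  refine tendsto_of_limRel_iff (Eventually.of_forall fun _ => rfl) fun a b => ?_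
  exact rel_one_iff.trans ((and_congr_right fun _ => (h a).symm).trans limRel_one_iff.symm)

/-- The nontrivial direction is that a limit of initial segments of the ranges begins r(g): joined
with the left component of a limit pair, it extends to another limit pair, which is related to g. -/
theorem continuous_r_pathGroupoid (hΛ : Λ.CompactlyAligned) : Continuous (pathGroupoid Λ).r := by
  rw [continuous_iff_ultrafilter]
  intro g 𝒰 h
  have h' : Tendsto id (𝒰 : Filter (pathGroupoid Λ).Mor) (𝓝 g) := h
  refine tendsto_of_limPre_iff fun a => ⟨fun ha => ?_, fun ha => ?_⟩
  · obtain ⟨a₀, b₀, h₀⟩ := exists_rel g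
    have h₁ := h₀.limRel h'
    obtain ⟨α, α', c, k1, k2, -, k3⟩ := h₁.limPre.join hΛ ha
    obtain ⟨e, -, k4⟩ := h₁.extend k1 k3
    exact (k4.rel h').pre_left.of_comp k2
  · obtain ⟨a₀, b₀, h₀⟩ := exists_rel g
    obtain ⟨α, α', c, e, -, k2, -, k4⟩ := h₀.join ha
    exact (k4.limRel h').limPre.of_comp k2

theorem continuous_s_pathGroupoid (hΛ : Λ.CompactlyAligned) : Continuous (pathGroupoid Λ).s :=
  (continuous_r_pathGroupoid hΛ).comp continuous_inv_pathGroupoid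

/-- Near a groupoid element, convergence can be tested on ranges. -/
theorem tendsto_of_tendsto_r {𝒰 : Ultrafilter ι} {g : ι → (pathGroupoid Λ).Mor}
    {g₀ : (pathGroupoid Λ).Mor} {a b : Λ.Mor}
    (hm : ∀ᶠ i in (𝒰 : Filter ι), (g i).1.2.1 = g₀.1.2.1)
    (hr : Tendsto (fun i => (pathGroupoid Λ).r (g i)) 𝒰 (𝓝 ((pathGroupoid Λ).r g₀)))
    (h₀ : Rel g₀ a b) (h : LimRel 𝒰 g a b) : Tendsto g 𝒰 (𝓝 g₀) := by
  refine tendsto_of_limRel_iff hm fun c e => ⟨fun hce => ?_, fun hce => ?_⟩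
  · obtain ⟨α, α', c', e', k1, k2, k3, k4⟩ := h₀.join hce.pre_left
    obtain ⟨e'', k5, k6⟩ := h.extend k1 ((limPre_iff_of_tendsto hr).2 k4.pre_left)
    obtain rfl := k5.unique k3
    exact k6.restrict k2 (hce.isComp_right k4 k2)
  · obtain ⟨α, α', c', e', k1, k2, k3, k4⟩ := h₀.join ((limPre_iff_of_tendsto hr).1 hce.limPre)
    obtain ⟨e'', k5, k6⟩ := h.extend k1 ((limPre_iff_of_tendsto hr).2 k4.pre_left)
    obtain rfl := k5.unique k3
    exact k4.restrict k2 (hce.isComp_right k6 k2)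

/-- A path x near r(g₀) has the form a'z with a' near a. Lifting s(a') through the local
homeomorphism s to b' near b gives (a'z, m, b'z), which has range x and tends to g₀. -/
theorem isOpenMap_r_pathGroupoid : IsOpenMap (pathGroupoid Λ).r := by
  refine IsOpenMap.of_nhds_le fun g₀ S hS => ?_
  rw [mem_iff_ultrafilter]
  intro 𝒰 h𝒰
  obtain ⟨a, b, h₀⟩ := exists_rel g₀
  have hx : Tendsto id (𝒰 : Filter (pathGroupoid Λ).Obj) (𝓝 ((pathGroupoid Λ).r g₀)) := h𝒰
  obtain ⟨a', h1, h2⟩ := (limPre_iff_of_tendsto hx).2 h₀.pre_left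
  have hs : Tendsto (fun x => Λ.s (a' x)) 𝒰 (𝓝 (Λ.s b)) := by
    rw [← h₀.s_eq]
    exact (Λ.continuous_s.tendsto a).comp h1
  obtain ⟨b', h3, h4⟩ := exists_tendsto_lift_s hs
  have h5 : ∀ᶠ x in (𝒰 : Filter (pathGroupoid Λ).Obj), ∃ g : (pathGroupoid Λ).Mor,
      (pathGroupoid Λ).r g = x ∧ Rel g (a' x) (b' x) ∧ g.1.2.1 = g₀.1.2.1 := by
    filter_upwards [h2, h4, eventually_d_eq h1, eventually_d_eq h3] with x ⟨z, hz⟩ h4 d1 d2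
    obtain ⟨g, k1, -, k3, k4⟩ := exists_rel_mk hz.s_eq (h4.trans hz.s_eq)
    refine ⟨g, k1.unique hz, k3, ?_⟩
    rw [k4]
    funext i
    rw [← h₀.sub_eq i, d1, d2]
  have : Nonempty (pathGroupoid Λ).Mor := ⟨g₀⟩
  obtain ⟨g, hg⟩ := h5.choice
  have h6 : Tendsto g 𝒰 (𝓝 g₀) := by
    refine tendsto_of_tendsto_r (hg.mono fun x hx => hx.2.2) ?_ h₀
      ⟨a', b', h1, h3, hg.mono fun x hx => hx.2.1⟩
    exact hx.congr' (hg.mono fun x hx => hx.1.symm)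
  filter_upwards [h6 hS, hg] with x hx hx'
  rw [← hx'.1]
  exact hx

theorem continuous_comp_pathGroupoid (hΛ : Λ.CompactlyAligned) :
    Continuous (pathGroupoid Λ).compMap := by
  rw [continuous_iff_ultrafilter]
  intro p 𝒰 h𝒰
  have hval : Continuous fun p : (pathGroupoid Λ).Composable =>
      (p.1 : (pathGroupoid Λ).Mor × (pathGroupoid Λ).Mor) := continuous_subtype_val
  have h1 : Tendsto (fun p : (pathGroupoid Λ).Composable => p.1.1) 𝒰 (𝓝 p.1.1) :=
    ((continuous_fst.comp hval).tendsto p).mono_left h𝒰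
  have h2 : Tendsto (fun p : (pathGroupoid Λ).Composable => p.1.2) 𝒰 (𝓝 p.1.2) :=
    ((continuous_snd.comp hval).tendsto p).mono_left h𝒰
  obtain ⟨a, b, c, hab, hbc⟩ := exists_rel_rel p.2
  refine tendsto_of_tendsto_r ?_ ?_ (hab.comp hbc p.2) ?_
  · filter_upwards [h1.eventually (eventually_cocycle_eq _),
      h2.eventually (eventually_cocycle_eq _)] with q hq hq'
    exact congrArg₂ (· + ·) hq hq'
  · have h3 : Tendsto (fun q : (pathGroupoid Λ).Composable => (pathGroupoid Λ).r q.1.1) 𝒰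
        (𝓝 ((pathGroupoid Λ).r p.1.1)) := ((continuous_r_pathGroupoid hΛ).tendsto _).comp h1
    exact h3
  · obtain ⟨a', b', k1, k2, k3⟩ := hab.limRel h1
    obtain ⟨b'', c', k4, k5, k6⟩ := hbc.limRel h2
    refine ⟨a', c', k1, k5, ?_⟩
    filter_upwards [k3, k6, eventually_d_eq k2, eventually_d_eq k4] with q k3 k6 d1 d2
    have e : q.1.1.1.2.2 = q.1.2.1.1 := q.2
    have hb := k3.pre_right
    rw [e] at hb
    -- The two approximations of b begin the same path with the same degree, so they are equal and
    -- the pairs compose.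
    rw [← hb.eq_of_d_eq k6.pre_left (d1.trans d2.symm)] at k6
    exact k3.comp k6 q.2

/-- Every groupoid element has a neighbourhood on which `r` is injective. -/
theorem exists_isOpen_injOn_r (g : (pathGroupoid Λ).Mor) :
    ∃ B : Set (pathGroupoid Λ).Mor, IsOpen B ∧ g ∈ B ∧ Set.InjOn (pathGroupoid Λ).r B := by
  obtain ⟨a, b, h⟩ := exists_rel g
  obtain ⟨V, hV, hbV, hinj⟩ := exists_isOpen_injOn_s b
  -- With the degree of the left component fixed, the range determines a and the remainder z;
  -- injectivity of s on V then determines b.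
  refine ⟨cylinder Λ (starS Λ (Λ.ofDegree (Λ.d a)) V) g.1.2.1,
    isOpen_cylinder (Λ.isOpen_ofDegree _) hV _,
    mem_cylinder_starS_iff.2 ⟨rfl, a, rfl, b, hbV, h⟩, ?_⟩
  intro g₁ h₁ g₂ h₂ hr
  obtain ⟨m₁, a₁, ha₁, b₁, hb₁, z₁, p1, p2, -⟩ := mem_cylinder_starS_iff.1 h₁
  obtain ⟨m₂, a₂, ha₂, b₂, hb₂, z₂, q1, q2, -⟩ := mem_cylinder_starS_iff.1 h₂
  have hr' : g₁.1.1 = g₂.1.1 := hr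
  rw [← hr'] at q1
  obtain ⟨rfl, rfl⟩ := p1.eq_of_d_eq q1 (Eq.trans ha₁ (Eq.symm ha₂))
  obtain rfl := hinj hb₁ hb₂ (p2.s_eq.trans q2.s_eq.symm)
  exact Subtype.ext (Prod.ext hr (Prod.ext (m₁.trans m₂.symm) (p2.unique q2)))

/-- Near the unit at x, related pairs can be taken in U × U with s injective on U; equal sources
force equal components. -/
theorem isRDiscrete_pathGroupoid : (pathGroupoid Λ).IsRDiscrete := by
  refine isOpen_iff_mem_nhds.2 ?_
  rintro _ ⟨x, rfl⟩
  obtain ⟨a, ha⟩ := exists_pre x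
  obtain ⟨U, hU, haU, hinj⟩ := exists_isOpen_injOn_s a
  have h : Rel ((pathGroupoid Λ).one x) a a := rel_one_iff.2 ⟨rfl, ha⟩
  filter_upwards [h.eventually_exists (hU.mem_nhds haU) (hU.mem_nhds haU)] with g
    ⟨hm, a', ha', b', hb', hg⟩
  obtain rfl := hinj ha' hb' hg.s_eq
  obtain ⟨z, h1, h2, -⟩ := hg
  exact ⟨g.1.1, Subtype.ext (Prod.ext rfl (Prod.ext hm.symm (h1.unique h2)))⟩

theorem isTopologicalGroupoid_pathGroupoid (hΛ : Λ.CompactlyAligned) :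
    (pathGroupoid Λ).IsTopologicalGroupoid where
  isEmbedding_one := ⟨⟨rfl⟩, fun _ _ h => congrArg (pathGroupoid Λ).r h⟩
  continuous_r := continuous_r_pathGroupoid hΛ
  continuous_s := continuous_s_pathGroupoid hΛ
  continuous_inv := continuous_inv_pathGroupoid
  continuous_comp := continuous_comp_pathGroupoid hΛ

/-! ### The basis and second countability -/

/-- Openness of composition splits the nearby c' and e'. Requiring both tails to lie in a set on
which s is injective makes the tails equal, so the pair can be restricted. -/
theorem exists_isOpen_restrict {a b c e α : Λ.Mor} (hc : IsComp a α c) (he : IsComp b α e)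
    {U V : Set Λ.Mor} (hU : U ∈ 𝓝 a) (hV : V ∈ 𝓝 b) :
    ∃ U' V' : Set Λ.Mor, IsOpen U' ∧ c ∈ U' ∧ IsOpen V' ∧ e ∈ V' ∧
      ∀ (g : (pathGroupoid Λ).Mor), ∀ c' ∈ U', ∀ e' ∈ V', Rel g c' e' →
        ∃ a' ∈ U, ∃ b' ∈ V, Rel g a' b' := by
  obtain ⟨A, hA, hαA, hinj⟩ := exists_isOpen_injOn_s α
  obtain ⟨U', hU', hUo, hcU⟩ :=
    mem_nhds_iff.1 (hc.eventually_exists hU (hA.mem_nhds hαA))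
  obtain ⟨V', hV', hVo, heV⟩ :=
    mem_nhds_iff.1 (he.eventually_exists hV (hA.mem_nhds hαA))
  refine ⟨U', V', hUo, hcU, hVo, heV, fun g c' hc' e' he' hg => ?_⟩
  obtain ⟨a', ha', α', hα', h1⟩ := hU' hc'
  obtain ⟨b', hb', β', hβ', h2⟩ := hV' he'
  obtain rfl := hinj hα' hβ' (by rw [← h1.s_eq, ← h2.s_eq, hg.s_eq])
  exact ⟨a', ha', b', hb', hg.restrict h1 h2⟩

/-- The two pairs witnessing membership of g have a common extension (c, e), and pairs near (c, e)
restrict to pairs in either product. -/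
theorem exists_cylinder_subset_inter {U₁ V₁ U₂ V₂ : Set Λ.Mor} (hU₁ : IsOpen U₁) (hV₁ : IsOpen V₁)
    (hU₂ : IsOpen U₂) (hV₂ : IsOpen V₂) {m : Fin k → ℤ} {g : (pathGroupoid Λ).Mor}
    (h₁ : g ∈ cylinder Λ (starS Λ U₁ V₁) m) (h₂ : g ∈ cylinder Λ (starS Λ U₂ V₂) m) :
    ∃ U V : Set Λ.Mor, IsOpen U ∧ IsOpen V ∧ g ∈ cylinder Λ (starS Λ U V) m ∧
      cylinder Λ (starS Λ U V) m ⊆ cylinder Λ (starS Λ U₁ V₁) m ∩ cylinder Λ (starS Λ U₂ V₂) m := by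
  obtain ⟨hm, a₁, ha₁, b₁, hb₁, k₁⟩ := mem_cylinder_starS_iff.1 h₁
  obtain ⟨-, a₂, ha₂, b₂, hb₂, k₂⟩ := mem_cylinder_starS_iff.1 h₂
  obtain ⟨α₁, α₂, c, e, p1, p2, p3, p4⟩ := k₁.join k₂.pre_left
  obtain ⟨U, V, hU, hcU, hV, heV, hUV⟩ :=
    exists_isOpen_restrict p1 p3 (hU₁.mem_nhds ha₁) (hV₁.mem_nhds hb₁)
  obtain ⟨U', V', hU', hcU', hV', heV', hUV'⟩ := exists_isOpen_restrict p2
    (k₂.isComp_right p4 p2) (hU₂.mem_nhds ha₂) (hV₂.mem_nhds hb₂)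
  refine ⟨U ∩ U', V ∩ V', hU.inter hU', hV.inter hV',
    mem_cylinder_starS_iff.2 ⟨hm, c, ⟨hcU, hcU'⟩, e, ⟨heV, heV'⟩, p4⟩, fun g' hg' => ?_⟩
  obtain ⟨hm', c', hc', e', he', hg'⟩ := mem_cylinder_starS_iff.1 hg'
  exact ⟨mem_cylinder_starS_iff.2 ⟨hm', hUV g' c' hc'.1 e' he'.1 hg'⟩,
    mem_cylinder_starS_iff.2 ⟨hm', hUV' g' c' hc'.2 e' he'.2 hg'⟩⟩

theorem isTopologicalBasis_basicSets (Λ : TopKGraph.{u, v} k) :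
    TopologicalSpace.IsTopologicalBasis (basicSets Λ) where
  exists_subset_inter := by
    rintro _ ⟨m, U₁, V₁, F₁, hU₁, hV₁, hF₁, hFc₁, rfl⟩ _
      ⟨m', U₂, V₂, F₂, hU₂, hV₂, hF₂, hFc₂, rfl⟩ g ⟨⟨h1, h2⟩, ⟨h3, h4⟩⟩
    obtain rfl : m = m' := (mem_cylinder_iff.1 h1).1.symm.trans (mem_cylinder_iff.1 h3).1
    obtain ⟨U, V, hU, hV, hg, hsub⟩ := exists_cylinder_subset_inter hU₁ hV₁ hU₂ hV₂ h1 h3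
    refine ⟨_, ⟨m, U, V, F₁ ∪ F₂, hU, hV, Set.union_subset hF₁ hF₂, hFc₁.union hFc₂, rfl⟩,
      ⟨hg, ?_⟩, fun g' hg' => ⟨⟨(hsub hg'.1).1, ?_⟩, (hsub hg'.1).2, ?_⟩⟩
    · rintro ⟨p, hp | hp, hh⟩
      · exact h2 ⟨p, hp, hh⟩
      · exact h4 ⟨p, hp, hh⟩
    · exact fun ⟨p, hp, hh⟩ => hg'.2 ⟨p, Or.inl hp, hh⟩
    · exact fun ⟨p, hp, hh⟩ => hg'.2 ⟨p, Or.inr hp, hh⟩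
  sUnion_eq := Set.eq_univ_of_forall fun g =>
    ⟨_, ⟨g.1.2.1, Set.univ, Set.univ, ∅, isOpen_univ, isOpen_univ, Set.empty_subset _,
      isCompact_empty, rfl⟩, mem_cylinder_univ g, fun ⟨_, hp, _⟩ => hp⟩
  eq_generateFrom := rfl

theorem exists_finite_subset_basis_between {X : Type*} [TopologicalSpace X] [LocallyCompactSpace X]
    [T2Space X] {B : Set (Set X)} (hB : TopologicalSpace.IsTopologicalBasis B) {F O : Set X}
    (hF : IsCompact F) (hO : IsOpen O) (h : F ⊆ O) :
    ∃ t ⊆ B, t.Finite ∧ F ⊆ closure (⋃₀ t) ∧ closure (⋃₀ t) ⊆ O ∧ IsCompact (closure (⋃₀ t)) := by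
  obtain ⟨K, hK, hFK, hKO⟩ := exists_compact_between hF hO h
  have key : ∃ t ⊆ B, t.Finite ∧ F ⊆ ⋃₀ t ∧ ⋃₀ t ⊆ K := by
    refine hF.induction_on (p := fun S => ∃ t ⊆ B, t.Finite ∧ S ⊆ ⋃₀ t ∧ ⋃₀ t ⊆ K)
      ⟨∅, Set.empty_subset _, Set.finite_empty, by simp, by simp⟩ ?_ ?_ ?_
    · rintro S S' hS ⟨t, h1, h2, h3, h4⟩
      exact ⟨t, h1, h2, hS.trans h3, h4⟩
    · rintro S S' ⟨t, h1, h2, h3, h4⟩ ⟨t', h1', h2', h3', h4'⟩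
      refine ⟨t ∪ t', Set.union_subset h1 h1', h2.union h2', ?_, ?_⟩
      · rw [Set.sUnion_union]; exact Set.union_subset_union h3 h3'
      · rw [Set.sUnion_union]; exact Set.union_subset h4 h4'
    · intro x hx
      obtain ⟨b, hb, hxb, hbK⟩ := hB.exists_subset_of_mem_open (hFK hx) isOpen_interior
      exact ⟨b, mem_nhdsWithin_of_mem_nhds ((hB.isOpen hb).mem_nhds hxb), {b}, by simpa using hb,
        Set.finite_singleton b, by simp, by simpa using hbK.trans interior_subset⟩
  obtain ⟨t, h1, h2, h3, h4⟩ := key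
  have h5 := closure_minimal h4 hK.isClosed
  exact ⟨t, h1, h2, h3.trans subset_closure, h5.trans hKO, hK.of_isClosed_subset isClosed_closure h5⟩

/-- U and V may be taken from a countable basis. The related pairs of g form a closed set, so F can
be enlarged, still avoiding them, to the compact closure of a finite union of basic sets; only
countably many such closures exist. -/
theorem secondCountableTopology_pathGroupoid :
    SecondCountableTopology (pathGroupoid Λ).Mor := by
  let B := TopologicalSpace.countableBasis Λ.Mor
  let B₂ := TopologicalSpace.countableBasis (Λ.Mor × Λ.Mor)
  have hB : TopologicalSpace.IsTopologicalBasis B := TopologicalSpace.isBasis_countableBasis _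
  have hB₂ : TopologicalSpace.IsTopologicalBasis B₂ := TopologicalSpace.isBasis_countableBasis _
  let I : Set ((Fin k → ℤ) × Set Λ.Mor × Set Λ.Mor × Set (Set (Λ.Mor × Λ.Mor))) :=
    Set.univ ×ˢ B ×ˢ B ×ˢ {t | t.Finite ∧ t ⊆ B₂}
  have hI : I.Countable := Set.countable_univ.prod ((TopologicalSpace.countable_countableBasis _).prod
    ((TopologicalSpace.countable_countableBasis _).prod
      (Set.countable_ofPred_finite_subset (TopologicalSpace.countable_countableBasis _))))
  let Φ : (Fin k → ℤ) × Set Λ.Mor × Set Λ.Mor × Set (Set (Λ.Mor × Λ.Mor)) →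
      Set (pathGroupoid Λ).Mor := fun q => cylinder Λ (starS Λ q.2.1 q.2.2.1) q.1 ∩
        (cylinder Λ (closure (⋃₀ q.2.2.2) ∩ starS Λ Set.univ Set.univ) q.1)ᶜ
  refine TopologicalSpace.IsTopologicalBasis.secondCountableTopology
    (b := Φ '' {q ∈ I | IsCompact (closure (⋃₀ q.2.2.2))})
    (TopologicalSpace.isTopologicalBasis_of_isOpen_of_nhds ?_ ?_)
    ((hI.mono (Set.sep_subset _ _)).image Φ)
  · rintro _ ⟨⟨m, U, V, t⟩, ⟨⟨-, hU, hV, -⟩, ht⟩, rfl⟩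
    exact TopologicalSpace.isOpen_generateFrom_of_mem ⟨m, U, V, _, hB.isOpen hU, hB.isOpen hV,
      Set.inter_subset_right, ht.inter_right isClosed_starS_univ, rfl⟩
  · intro g W hg hW
    obtain ⟨_, ⟨m, U, V, F, hU, hV, hF, hFc, rfl⟩, ⟨h1, h2⟩, hsub⟩ :=
      (isTopologicalBasis_basicSets Λ).exists_subset_of_mem_open hg hW
    obtain ⟨hm, a, ha, b, hb, hab⟩ := mem_cylinder_starS_iff.1 h1
    obtain ⟨U', hU', haU', hUU'⟩ := hB.exists_subset_of_mem_open ha hU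
    obtain ⟨V', hV', hbV', hVV'⟩ := hB.exists_subset_of_mem_open hb hV
    obtain ⟨t, ht, htf, hFt, htg, htc⟩ := exists_finite_subset_basis_between hB₂ hFc
      (isClosed_rel g).isOpen_compl fun p hp hp' => h2 (mem_cylinder_iff.2 ⟨hm, p, hp, hp'⟩)
    refine ⟨_, ⟨(m, U', V', t), ⟨⟨trivial, hU', hV', htf, ht⟩, htc⟩, rfl⟩,
      ⟨mem_cylinder_starS_iff.2 ⟨hm, a, haU', b, hbV', hab⟩, ?_⟩, ?_⟩
    · intro hcon
      obtain ⟨-, p, hp, hp'⟩ := mem_cylinder_iff.1 hcon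
      exact htg hp.1 hp'
    · rintro g' ⟨h3, h4⟩
      obtain ⟨hm', a', ha', b', hb', hab'⟩ := mem_cylinder_starS_iff.1 h3
      refine hsub ⟨mem_cylinder_starS_iff.2 ⟨hm', a', hUU' ha', b', hVV' hb', hab'⟩, ?_⟩
      rintro ⟨p, hp, hp'⟩
      exact h4 ⟨p, ⟨hFt hp, hF hp⟩, hp'⟩

/-! ### The Haar system of counting measures -/

/-- The integral of a function with finite support on `S` with respect to counting measure
on `S`. -/
theorem integral_count_restrict_eq_finsum {X E : Type*} [MeasurableSpace X]
    [MeasurableSingletonClass X] [NormedAddCommGroup E] [NormedSpace ℝ E] [CompleteSpace E]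
    {S : Set X} (hS : MeasurableSet S) (f : X → E) (hf : (S ∩ Function.support f).Finite) :
    ∫ x, f x ∂(Measure.count.restrict S) = ∑ᶠ x ∈ S, f x := by
  rw [← finsum_mem_inter_support, finsum_mem_eq_finite_toFinset_sum _ hf,
    setIntegral_eq_of_subset_of_forall_sdiff_eq_zero (s := S ∩ Function.support f) hS
      Set.inter_subset_left fun x hx => by
        by_contra hne
        exact hx.2 ⟨hx.1, hne⟩]
  have h1 : S ∩ Function.support f = (hf.toFinset : Set X) := by simp
  have h2 : IntegrableOn f (hf.toFinset : Set X) Measure.count := by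
    rw [← Set.biUnion_of_singleton (hf.toFinset : Set X)]
    exact integrableOn_finset_iUnion.2 fun x _ => 
      integrableOn_singleton (hx := Measure.count_apply_lt_top.2 (Set.finite_singleton x))
  conv_lhs => rw [h1]
  rw [setIntegral_finset _ h2]
  simp

section EtaleFibers

variable {G X E : Type*} [TopologicalSpace G] {r : G → X}

/-- Finitely many sets on which r is injective cover K, and each meets a fibre at most once. -/
theorem finite_inter_fiber (hinj : ∀ g, ∃ B, IsOpen B ∧ g ∈ B ∧ Set.InjOn r B) {K : Set G}
    (hK : IsCompact K) (x : X) : (K ∩ r ⁻¹' {x}).Finite := by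
  refine hK.induction_on (p := fun S => (S ∩ r ⁻¹' {x}).Finite) (by simp) ?_ ?_ ?_
  · exact fun S S' h h' => h'.subset (Set.inter_subset_inter_left _ h)
  · intro S S' h h'
    rw [Set.union_inter_distrib_right]
    exact h.union h'
  · intro g _
    obtain ⟨B, hB, hg, hi⟩ := hinj g
    refine ⟨B, mem_nhdsWithin_of_mem_nhds (hB.mem_nhds hg), Set.Subsingleton.finite ?_⟩
    rintro a ⟨ha, ha'⟩ b ⟨hb, hb'⟩
    exact hi ha hb (Eq.trans ha' (Eq.symm hb'))

/-- For an étale map `r`, the sums over the fibres of `r` of a continuous function with compact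
support depend continuously on the base point. -/
theorem continuous_finsum_fiber [TopologicalSpace X] [T2Space G] [T2Space X]
    [AddCommMonoid E] [TopologicalSpace E] [ContinuousAdd E]
    (hr : Continuous r) (hro : IsOpenMap r)
    (hinj : ∀ g, ∃ B, IsOpen B ∧ g ∈ B ∧ Set.InjOn r B) {f : G → E} (hf : Continuous f)
    (hfc : HasCompactSupport f) : Continuous fun x => ∑ᶠ g ∈ r ⁻¹' {x}, f g := by
  rw [continuous_iff_continuousAt]
  intro x₀
  have hT := finite_inter_fiber hinj hfc x₀
  -- The finitely many points of the support over x₀ receive disjoint sheets `B g`, each with a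
  -- local section σ of r.
  obtain ⟨D, hD, hDd⟩ := hT.t2_separation
  choose B₀ hB₀ hgB₀ hB₀inj using hinj
  let B : G → Set G := fun g => D g ∩ B₀ g
  have hB : ∀ g, IsOpen (B g) := fun g => (hD g).2.inter (hB₀ g)
  have hgB : ∀ g, g ∈ B g := fun g => ⟨(hD g).1, hgB₀ g⟩
  have hBinj : ∀ g, Set.InjOn r (B g) := fun g => (hB₀inj g).mono Set.inter_subset_right
  let T := hT.toFinset
  have hTx : ∀ g ∈ T, r g = x₀ := fun g hg => (hT.mem_toFinset.1 hg).2
  have hσ₀ : ∀ g, ∃ σ : X → G, ∀ h ∈ B g, σ (r h) = h := fun g =>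
    have : Nonempty G := ⟨g⟩
    ⟨Function.invFunOn r (B g), (hBinj g).leftInvOn_invFunOn⟩
  choose σ hσ using hσ₀
  have hσt : ∀ g ∈ T, Tendsto (fun x => f (σ g x)) (𝓝 x₀) (𝓝 (f g)) := by
    intro g hg N hN
    have h1 : {h | h ∈ B g ∧ f h ∈ N} ∈ 𝓝 g :=
      inter_mem ((hB g).mem_nhds (hgB g)) (hf.continuousAt hN)
    have h2 := hro.image_mem_nhds h1
    rw [hTx g hg] at h2
    rw [mem_map]
    filter_upwards [h2]
    rintro _ ⟨h, ⟨hh, hh'⟩, rfl⟩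
    rw [Set.mem_preimage, hσ g h hh]
    exact hh'
  -- The part of the support outside the sheets has compact image missing x₀, so over nearby points
  -- only the sheets contribute.
  have hcl : IsClosed (r '' (tsupport f \ ⋃ g ∈ T, B g)) :=
    ((hfc.isCompact.diff (isOpen_biUnion fun g _ => hB g)).image hr).isClosed
  have hx₀ : x₀ ∉ r '' (tsupport f \ ⋃ g ∈ T, B g) := by
    rintro ⟨g, ⟨hg, hg'⟩, e⟩
    exact hg' (Set.mem_biUnion (hT.mem_toFinset.2 ⟨hg, e⟩) (hgB g))
  have hW : ∀ᶠ x in 𝓝 x₀, ∑ᶠ g ∈ r ⁻¹' {x}, f g = ∑ g ∈ T, f (σ g x) := by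
    have h1 : ∀ᶠ x in 𝓝 x₀, ∀ g ∈ T, x ∈ r '' B g := by
      rw [eventually_all_finset]
      intro g hg
      exact hTx g hg ▸ hro.image_mem_nhds ((hB g).mem_nhds (hgB g))
    filter_upwards [h1, hcl.isOpen_compl.mem_nhds hx₀] with x h1 h2
    have h3 : ∀ g ∈ T, σ g x ∈ B g ∧ r (σ g x) = x := by
      intro g hg
      obtain ⟨h, hh, rfl⟩ := h1 g hg
      rw [hσ g h hh]
      exact ⟨hh, rfl⟩
    have h4 : Set.InjOn (fun g => σ g x) (T : Set G) := by
      intro g hg g' hg' e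
      by_contra hne
      have e' : σ g x = σ g' x := e
      exact Set.disjoint_left.1 (hDd (hT.mem_toFinset.1 hg) (hT.mem_toFinset.1 hg') hne)
        (h3 g hg).1.1 (e' ▸ (h3 g' hg').1.1)
    rw [← finsum_mem_coe_finset, ← finsum_mem_image h4]
    refine finsum_mem_inter_support_eq' _ _ _ fun h hh => ⟨fun hx => ?_, ?_⟩
    · have hx' : r h = x := hx
      by_contra hcon
      refine h2 ⟨h, ⟨subset_tsupport f hh, fun hmem => ?_⟩, hx'⟩
      obtain ⟨g, hg, hhg⟩ := Set.mem_iUnion₂.1 hmem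
      exact hcon ⟨g, hg, by rw [← hx']; exact hσ g h hhg⟩
    · rintro ⟨g, hg, rfl⟩
      exact (h3 g hg).2
  have h5 : Tendsto (fun x => ∑ g ∈ T, f (σ g x)) (𝓝 x₀) (𝓝 (∑ g ∈ T, f g)) :=
    tendsto_finsetSum _ hσt
  have h6 : ∑ᶠ g ∈ r ⁻¹' {x₀}, f g = ∑ g ∈ T, f g := by
    rw [hW.self_of_nhds]
    refine Finset.sum_congr rfl fun g hg => ?_
    rw [← hTx g hg, hσ g g (hgB g)]
  rw [ContinuousAt, h6]
  exact h5.congr' (hW.mono fun x hx => hx.symm)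

end EtaleFibers

theorem t2Space_obj_pathGroupoid : T2Space (pathGroupoid Λ).Obj :=
  have := t2Space_pathGroupoid (Λ := Λ)
  IsEmbedding.t2Space (f := (pathGroupoid Λ).one)
    ⟨⟨rfl⟩, fun _ _ h => congrArg (pathGroupoid Λ).r h⟩

theorem isClosed_rFiber (hΛ : Λ.CompactlyAligned) (x : (pathGroupoid Λ).Obj) :
    IsClosed ((pathGroupoid Λ).rFiber x) :=
  have := t2Space_obj_pathGroupoid (Λ := Λ)
  isClosed_singleton.preimage (continuous_r_pathGroupoid hΛ)

/-- Left multiplication by `g` is a bijection from `G^{s(g)}` onto `G^{r(g)}`. -/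
theorem SmallGroupoid.bijOn_rFiber (G : SmallGroupoid.{u, v}) (g : G.Mor) {t : G.Mor → G.Mor}
    (ht : ∀ h (e : G.s g = G.r h), t h = G.comp g h e) :
    Set.BijOn t (G.rFiber (G.s g)) (G.rFiber (G.r g)) := by
  have cancel : ∀ (a b c : G.Mor) (hab : G.s a = G.r b) (hbc : G.s b = G.r c),
      G.comp a b hab = G.one (G.s b) → G.comp a (G.comp b c hbc)
        (hab.trans (G.r_comp _ _ _).symm) = c := by
    intro a b c hab hbc e
    rw [← G.assoc a b c hab hbc]
    -- The composability proof depends on the left factor, so that factor is generalized before it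
    -- is replaced by a unit.
    have : ∀ w (hw : G.s w = G.r c), w = G.one (G.s b) → G.comp w c hw = c := by
      rintro w hw rfl
      have : ∀ o (ho : G.s (G.one o) = G.r c), o = G.r c → G.comp (G.one o) c ho = c := by
        rintro o ho rfl
        exact G.one_comp c
      exact this _ hw hbc
    exact this _ _ e
  have hg' : G.comp g (G.inv g) (G.r_inv g).symm = G.one (G.s (G.inv g)) := by
    rw [G.comp_inv, G.s_inv]
  refine ⟨fun h hh => ?_, fun h hh h' hh' e => ?_, fun h hh => ?_⟩
  · rw [ht h (Eq.symm hh)]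
    exact G.r_comp _ _ _
  · have hh : G.r h = G.s g := hh
    have hh' : G.r h' = G.s g := hh'
    rw [ht h hh.symm, ht h' hh'.symm] at e
    rw [← cancel (G.inv g) g h (G.s_inv g) hh.symm (G.inv_comp g),
      ← cancel (G.inv g) g h' (G.s_inv g) hh'.symm (G.inv_comp g)]
    simp only [e]
  · have hh : G.r h = G.r g := hh
    have e : G.s (G.inv g) = G.r h := (G.s_inv g).trans hh.symm
    refine ⟨G.comp (G.inv g) h e, (G.r_comp _ _ _).trans (G.r_inv g), ?_⟩
    rw [ht _ ((G.r_inv g).symm.trans (G.r_comp _ _ _).symm)]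
    exact cancel g (G.inv g) h (G.r_inv g).symm e hg'

/-- Local injectivity of r makes the fibre counting measures locally finite, hence regular on this
second-countable locally compact Hausdorff space. Integrals are finite fibre sums, to which
`continuous_finsum_fiber` applies, and left translation merely permutes their terms. -/
theorem isHaarSystem_pathGroupoid (hΛ : Λ.CompactlyAligned) :
    (pathGroupoid Λ).IsHaarSystem fun x => Measure.count.restrict ((pathGroupoid Λ).rFiber x) := by
  have := t2Space_pathGroupoid (Λ := Λ)
  have := t2Space_obj_pathGroupoid (Λ := Λ)
  have := secondCountableTopology_pathGroupoid (Λ := Λ)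
  have := locallyCompactSpace_pathGroupoid hΛ
  have hmeas := fun x => (isClosed_rFiber hΛ x).measurableSet
  have hfin : ∀ {E : Type} [Zero E] (f : (pathGroupoid Λ).Mor → E), HasCompactSupport f → ∀ x,
      ((pathGroupoid Λ).rFiber x ∩ Function.support f).Finite := fun f hf x => by
    rw [Set.inter_comm]
    exact (finite_inter_fiber exists_isOpen_injOn_r hf x).subset
      (Set.inter_subset_inter_left _ (subset_tsupport f))
  refine ⟨fun x => ?_, fun x => ?_, fun f hf hfc => ?_, fun f hf hfc g => ?_⟩
  · have : IsLocallyFiniteMeasure (Measure.count.restrict ((pathGroupoid Λ).rFiber x)) := by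
      refine ⟨fun g => ?_⟩
      obtain ⟨B, hB, hg, hinj⟩ := exists_isOpen_injOn_r g
      refine ⟨B, hB.mem_nhds hg, ?_⟩
      rw [Measure.restrict_apply hB.measurableSet]
      refine Measure.count_apply_lt_top.2 (Set.Subsingleton.finite ?_)
      rintro a ⟨ha, ha'⟩ b ⟨hb, hb'⟩
      exact hinj ha hb (Eq.trans ha' (Eq.symm hb'))
    infer_instance
  · ext g
    rw [Measure.mem_support_iff_forall]
    constructor
    · intro h
      by_contra hcon
      have := h _ ((isClosed_rFiber hΛ x).isOpen_compl.mem_nhds hcon)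
      rw [Measure.restrict_apply (hmeas x).compl] at this
      simp at this
    · intro hg U hU
      refine lt_of_lt_of_le ?_ (measure_mono (Set.singleton_subset_iff.2 (mem_of_mem_nhds hU)))
      rw [Measure.restrict_apply (measurableSet_singleton g),
        Set.inter_eq_left.2 (Set.singleton_subset_iff.2 hg), Measure.count_singleton]
      exact one_pos
  · have h1 := continuous_finsum_fiber (continuous_r_pathGroupoid hΛ) isOpenMap_r_pathGroupoid
      exists_isOpen_injOn_r hf hfc
    refine h1.congr fun x => ?_
    exact (integral_count_restrict_eq_finsum (hmeas x) f (hfin f hfc x)).symm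
  · classical
    -- The value of t off the fibre over s(g) is irrelevant, since both integrals only see fibres.
    let t : (pathGroupoid Λ).Mor → (pathGroupoid Λ).Mor := fun h =>
      if e : (pathGroupoid Λ).s g = (pathGroupoid Λ).r h then (pathGroupoid Λ).comp g h e else h
    have ht : ∀ h e, t h = (pathGroupoid Λ).comp g h e := fun h e => dif_pos e
    have hbij := (pathGroupoid Λ).bijOn_rFiber g ht
    have heq : ∀ h ∈ (pathGroupoid Λ).rFiber ((pathGroupoid Λ).s g),
        (if e : (pathGroupoid Λ).s g = (pathGroupoid Λ).r h then
          f ((pathGroupoid Λ).comp g h e) else 0) = f (t h) := by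
      intro h hh
      have e : (pathGroupoid Λ).s g = (pathGroupoid Λ).r h := Eq.symm hh
      rw [dif_pos e, ht h e]
    rw [integral_count_restrict_eq_finsum (hmeas _) f (hfin f hfc _),
      integral_count_restrict_eq_finsum (hmeas _)]
    · exact finsum_mem_eq_of_bijOn t hbij heq
    -- Left translation embeds the support of the translated function in the finite support of f on
    -- the fibre over r(g).
    · refine Set.Finite.of_finite_image ((hfin f hfc ((pathGroupoid Λ).r g)).subset ?_)
        (hbij.injOn.mono Set.inter_subset_left)
      rintro _ ⟨h, ⟨hh, hne⟩, rfl⟩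
      exact ⟨hbij.mapsTo hh, fun h0 => hne ((heq h hh).trans h0)⟩

end KGraph

theorem mainTheorem1 {k : ℕ} (Λ : KGraph.TopKGraph.{u, v} k) (hΛ : Λ.CompactlyAligned) :
    TopologicalSpace.IsTopologicalBasis (KGraph.basicSets Λ) ∧
    SecondCountableTopology (KGraph.pathGroupoid Λ).Mor ∧
    T2Space (KGraph.pathGroupoid Λ).Mor ∧
    LocallyCompactSpace (KGraph.pathGroupoid Λ).Mor ∧
    (KGraph.pathGroupoid Λ).IsTopologicalGroupoid ∧
    (KGraph.pathGroupoid Λ).IsRDiscrete ∧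
    ∃ ν : (KGraph.pathGroupoid Λ).Obj → MeasureTheory.Measure (KGraph.pathGroupoid Λ).Mor,
      (KGraph.pathGroupoid Λ).IsHaarSystem ν ∧
      ∀ x, ν x = MeasureTheory.Measure.count.restrict ((KGraph.pathGroupoid Λ).rFiber x) :=
  ⟨KGraph.isTopologicalBasis_basicSets Λ, KGraph.secondCountableTopology_pathGroupoid,
    KGraph.t2Space_pathGroupoid, KGraph.locallyCompactSpace_pathGroupoid hΛ,
    KGraph.isTopologicalGroupoid_pathGroupoid hΛ, KGraph.isRDiscrete_pathGroupoid,
    _, KGraph.isHaarSystem_pathGroupoid hΛ, fun _ => rfl⟩
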